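/- **Conventions.** A map $\mathcal M=(V,E,F,\mathbf I)$ is a 2-cell embedding of a connected graph without loops (multiple edges allowed, at least one edge) in a connected, not necessarily compact, surface without boundary. It is regarded as an incidence configuration of vertices, edges and faces in which each face $f$ carries its boundary cycle $C(f)$, a cyclic sequence of arcs determined up to starting point and direction; a vertex or edge is incident with $f$ when it lies on $C(f)$. It is *locally finite* if all vertices lie on finitely many edges and all boundary cycles are finite. The *face length* of $f$ is $|E_F(f)|$, where $E_F(f)$ is the set of edges incident with $f$. Automorphisms and isomorphisms are bijections on vertices, edges and faces preserving incidence and boundary cycles; they are written as exponents and act on the right, and $z^a=a^{-1}za$. For $G\le\mathrm{Aut}\,\mathcal M$, the map is *$G$-vertex-rotary* if $G$ is transitive on arcs (incident vertex-edge pairs) and each vertex stabiliser $G_\alpha$ induces a transitive cyclic group on the set of edges at $\alpha$. It is *$G$-face-rotary* if $G$ is transitive on arcs and each $G_f$ induces a cyclic group on $E_F(f)$. It is *$G$-rotary* if it is both $G$-vertex-rotary and $G$-face-rotary, and *$G$-bi-rotary* if it is $G$-vertex-rotary but not $G$-face-rotary. A *rotary pair* for a group $G$ is a pair $(a,z)$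 with $G=\langle a,z\rangle$, $|a|$ finite, $|z|=2$ and $z\notin\langle a\rangle$. Let $(a,z)$ be a rotary pair for a group $G$ such that $|a|\ge 3$ and $\langle a\rangle\ne\langle a\rangle^z$. In both constructions below the vertices and edges are the right cosets of $\langle a\rangle$ and of $\langle z\rangle$ in $G$, with incidence given by non-empty intersection. * If $m=|az|$ is finite, $\mathsf{RotaMap}(G,a,z)$ has as faces the right cosets of $\langle az\rangle$, with all incidences given by non-empty intersection. The boundary cycle of the face $\langle az\rangle g$ is $C(az)g$, where $C(az)=(e_0,\dots,e_{m-1})$ and $e_i=\langle z\rangle(az)^i$ is traversed from $\langle a\rangle(az)^i$ to $\langle a\rangle(az)^{i+1}$. * If $\ell=|zz^a|$ is finite, put $u=zz^a$. The faces of $\mathsf{BiRoMap}(G,a,z)$ are the cycles $C(zz^a)g$ with $g\in G$ (up to starting point and direction), each being its own boundary cycle and incident with the edges on it and the ends of these. Here $C(zz^a)=(e'_0,\dots,e'_{2\ell-1})$, where $e'_{2i}=\langle z\rangle u^i$ is traversed from $\langle a\rangle zu^i$ to $\langle a\rangle u^i$, and $e'_{2i+1}=\langle z\rangle au^i$ from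 $\langle a\rangle u^i$ to $\langle a\rangle zu^{i+1}$. **Theorem.** Let $\mathcal M=(V,E,F,\mathbf I)$ be a locally finite $G$-vertex-rotary map, where $G\le\mathrm{Aut}\,\mathcal M$, with $|V|\ge 3$ and $|F|\ge 3$, and let $(\alpha,e)$ be an arc. Then $e$ is incident with exactly two faces. Let these be $f,f'$, in either order. 1. There is a rotary pair $(a,z)$ for $G$ with $G_\alpha=\langle a\rangle$ and $G_e=\langle z\rangle$ such that $a$ rotates one step about $\alpha$ across $f'$, that is, $e$ and $e^a$ are consecutive at $\alpha$ on $C(f')$. 2. For every such pair, $f^a=f'$, $|a|\ge 3$, $\langle a\rangle\neq\langle a\rangle^z$, and one of the following holds: * (a) $z$ interchanges $f$ and $f'$, $|az|$ is finite, and $\mathcal M$ is the $G$-rotary map $\mathsf{RotaMap}(G,a,z)$, with all face lengths equal to $|az|$; or * (b) $z$ fixes each of $f$ and $f'$, $|zz^a|$ is finite, and $\mathcal M$ is the $G$-bi-rotary map $\mathsf{BiRoMap}(G,a,z)$, with all face lengths equal to $2|zz^a|$. Here "$\mathcal M$ is" means that there is a $G$-equivariant isomorphism taking $\alpha$ to $\langle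 a\rangle$, $e$ to $\langle z\rangle$, and taking $f$ to $\langle az\rangle$ in (a), respectively $f'$ to $C(zz^a)$ in (b); $G$ acts on the constructed maps by right multiplication. -/

import Mathlib

/-! ### Arcs and sequence classes of closed walks -/

/-- An (oriented) arc `(src, edge, tgt)`: the edge `edge` traversed from `src` to `tgt`. -/
@[ext]
structure Arc (V E : Type*) where
  src : V
  edge : E
  tgt : V

namespace Arc

/-- The same edge traversed in the opposite direction. -/
def rev {V E : Type*} (p : Arc V E) : Arc V E := ⟨p.tgt, p.edge, p.src⟩

/-- The image of an arc under a pair of maps on vertices and edges. -/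
def map {V E V' E' : Type*} (φ : V → V') (ψ : E → E') (p : Arc V E) : Arc V' E' :=
  ⟨φ p.src, ψ p.edge, φ p.tgt⟩

end Arc

/-- Two (cyclic) arc sequences are sequence equivalent if one is obtained from the other by
changing the starting point and possibly reversing the direction of travel. -/
def SeqEquiv {V E : Type*} (w w' : List (Arc V E)) : Prop :=
  w.IsRotated w' ∨ (w.map Arc.rev).reverse.IsRotated w'

/-- The sequence class of a cyclic arc sequence. -/
def seqClass {V E : Type*} (w : List (Arc V E)) : Set (List (Arc V E)) :=
  {w' | SeqEquiv w w'}

/-! ### Incidence configurations with specified boundary cycles, and maps -/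

/-- An incidence configuration `(V, E, F, I)` of vertices, edges and faces, together with a set
of arc sequences `boundary f` for each face `f` (for a map: the sequence class `C(f)`). -/
structure MapConfig (V E F : Type*) where
  incVE : V → E → Prop
  incVF : V → F → Prop
  incEF : E → F → Prop
  boundary : F → Set (List (Arc V E))

namespace MapConfig

section Basic

variable {V E F : Type*} (M : MapConfig V E F)

/-- `E(α)`: the edges incident with the vertex `α`. -/
def edgesAt (α : V) : Set E := {e | M.incVE α e}

/-- `E_F(f)`: the edges incident with the face `f`. -/
def edgesOf (f : F) : Set E := {e | M.incEF e f}

/-- The face length `|E_F(f)|` of the face `f`. -/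
noncomputable def faceLength (f : F) : ℕ := (M.edgesOf f).ncard

/-- Two vertices are adjacent if they are the two ends of some edge. -/
def Adj (α β : V) : Prop := α ≠ β ∧ ∃ e, M.incVE α e ∧ M.incVE β e

/-- `p` is an arc of the underlying graph. -/
def IsArc (p : Arc V E) : Prop :=
  p.src ≠ p.tgt ∧ M.incVE p.src p.edge ∧ M.incVE p.tgt p.edge

/-- `w` is a non-empty closed walk of the underlying graph: each arc ends where the cyclically
next one begins. -/
def IsClosedWalk (w : List (Arc V E)) : Prop :=
  w ≠ [] ∧ (∀ p ∈ w, M.IsArc p) ∧ Cycle.Chain (fun p q : Arc V E => p.tgt = q.src) (w : Cycle (Arc V E))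

/-- The edges `e, e'` are consecutive at the vertex `α` on the boundary cycle of the face `f`:
the boundary cycle, suitably started and directed, begins `[β, e, α], [α, e', γ]`. -/
def Consecutive (f : F) (α : V) (e e' : E) : Prop :=
  ∃ β γ l, (⟨β, e, α⟩ :: ⟨α, e', γ⟩ :: l : List (Arc V E)) ∈ M.boundary f

/-- `(V, E, F, I)` is a locally finite map, that is, a 2-cell embedding of a connected, locally
finite graph without loops (multiple edges allowed) in a connected surface without boundary,
with all faces of finite length. It is described by its cell structure: each face is an open
disc, attached to the graph along a closed walk, and sewing these discs together along the edges
gives a surface. The latter means that each edge is a side of discs exactly twice, and that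
the corners at any vertex fit together to a single disc. The edges and vertices incident with a
face are those on its boundary. The surface is compact exactly if there are finitely many cells,
which is not required. The boundary walks may have any length and may repeat edges. -/
structure IsLocallyFiniteMap : Prop where
  /-- there is an edge -/
  nonempty : Nonempty E
  /-- each edge is incident with exactly two vertices -/
  two_ends : ∀ e, {α | M.incVE α e}.encard = 2
  /-- each vertex is incident with finitely many edges -/
  finite_edgesAt : ∀ α, (M.edgesAt α).Finite
  /-- the underlying graph is connected -/
  connected : ∀ α β, Relation.ReflTransGen M.Adj α β
  /-- each face is bounded by a closed walk, and each edge is a side of a face exactly twice: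
  there are exactly two pairs `(f, i)` such that the walk around `f` has `e` in position `i` -/
  boundary_walks : ∃ w : F → List (Arc V E),
    (∀ f, M.IsClosedWalk (w f) ∧ M.boundary f = seqClass (w f)) ∧
    ∀ e, {p : F × ℕ | ((w p.1)[p.2]?).map Arc.edge = some e}.encard = 2
  /-- the edges at a vertex form a single cycle under being consecutive on a face at that vertex
  (each edge is in two corners there, as it is a side of a face twice; connectedness is what is left) -/
  link_connected : ∀ α, ∀ e ∈ M.edgesAt α, ∀ e' ∈ M.edgesAt α,
    Relation.ReflTransGen (fun x y => ∃ f, M.Consecutive f α x y) e e'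
  incEF_iff : ∀ e f, M.incEF e f ↔ ∃ w ∈ M.boundary f, ∃ p ∈ w, p.edge = e
  incVF_iff : ∀ α f, M.incVF α f ↔ ∃ w ∈ M.boundary f, ∃ p ∈ w, p.src = α

end Basic

/-! ### Isomorphisms and automorphisms -/

/-- An isomorphism of configurations: bijections on vertices, edges and faces that preserve all
incidences and carry the boundary cycle of each face to the boundary cycle of its image. -/
@[ext]
structure Iso {V E F V' E' F' : Type*} (M : MapConfig V E F) (N : MapConfig V' E' F') where
  onV : V ≃ V'
  onE : E ≃ E'
  onF : F ≃ F'
  incVE_iff : ∀ α e, N.incVE (onV α) (onE e) ↔ M.incVE α e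
  incVF_iff : ∀ α f, N.incVF (onV α) (onF f) ↔ M.incVF α f
  incEF_iff : ∀ e f, N.incEF (onE e) (onF f) ↔ M.incEF e f
  boundary_eq : ∀ f, N.boundary (onF f) = List.map (Arc.map onV onE) '' M.boundary f

/-- The automorphisms of a configuration. -/
abbrev Aut {V E F : Type*} (M : MapConfig V E F) := Iso M M

section Aut

variable {V E F : Type*} {M : MapConfig V E F}

/-- Automorphisms act on the right: `g * h` is `g` followed by `h`. -/
instance : Mul M.Aut where
  mul g h :=
    { onV := g.onV.trans h.onV
      onE := g.onE.trans h.onE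
      onF := g.onF.trans h.onF
      incVE_iff := fun α e => (h.incVE_iff _ _).trans (g.incVE_iff _ _)
      incVF_iff := fun α e => (h.incVF_iff _ _).trans (g.incVF_iff _ _)
      incEF_iff := fun α e => (h.incEF_iff _ _).trans (g.incEF_iff _ _)
      boundary_eq := fun f => by
        rw [Equiv.trans_apply, h.boundary_eq, g.boundary_eq, Set.image_image]
        simp only [List.map_map]
        rfl }

instance : One M.Aut where
  one :=
    { onV := Equiv.refl V
      onE := Equiv.refl E
      onF := Equiv.refl F
      incVE_iff := fun _ _ => Iff.rfl
      incVF_iff := fun _ _ => Iff.rfl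
      incEF_iff := fun _ _ => Iff.rfl
      boundary_eq := fun f => by
        have h : Arc.map (Equiv.refl V) (Equiv.refl E) = id := rfl
        rw [h, List.map_id_fun, Set.image_id, Equiv.refl_apply] }

instance : Inv M.Aut where
  inv g :=
    { onV := g.onV.symm
      onE := g.onE.symm
      onF := g.onF.symm
      incVE_iff := fun α e => by rw [← g.incVE_iff]; simp
      incVF_iff := fun α e => by rw [← g.incVF_iff]; simp
      incEF_iff := fun α e => by rw [← g.incEF_iff]; simp
      boundary_eq := fun f => by
        have h : Arc.map g.onV.symm g.onE.symm ∘ Arc.map g.onV g.onE = id := by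
          funext p; simp [Arc.map]
        have h2 := g.boundary_eq (g.onF.symm f)
        rw [Equiv.apply_symm_apply] at h2
        rw [h2, Set.image_image]
        simp [h] }

instance : Group M.Aut :=
  Group.ofLeftAxioms (fun _ _ _ => rfl) (fun _ => rfl) (fun g => by
    refine Iso.ext ?_ ?_ ?_
    · exact g.onV.symm_trans_self
    · exact g.onE.symm_trans_self
    · exact g.onF.symm_trans_self)

end Aut

/-! ### Vertex-rotary, rotary and bi-rotary maps -/

section Rotary

variable {V E F : Type*} {M : MapConfig V E F}

/-- The stabiliser `G_α` of a vertex. -/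
def stabV (G : Subgroup M.Aut) (α : V) : Subgroup G where
  carrier := {g | g.1.onV α = α}
  one_mem' := rfl
  mul_mem' {g h} (hg : g.1.onV α = α) (hh : h.1.onV α = α) := by
    change h.1.onV (g.1.onV α) = α
    rw [hg, hh]
  inv_mem' {g} (hg : g.1.onV α = α) := by
    change g.1.onV.symm α = α
    rw [Equiv.symm_apply_eq, hg]

/-- The stabiliser `G_e` of an edge. -/
def stabE (G : Subgroup M.Aut) (e : E) : Subgroup G where
  carrier := {g | g.1.onE e = e}
  one_mem' := rfl
  mul_mem' {g h} (hg : g.1.onE e = e) (hh : h.1.onE e = e) := by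
    change h.1.onE (g.1.onE e) = e
    rw [hg, hh]
  inv_mem' {g} (hg : g.1.onE e = e) := by
    change g.1.onE.symm e = e
    rw [Equiv.symm_apply_eq, hg]

/-- The stabiliser `G_f` of a face. -/
def stabF (G : Subgroup M.Aut) (f : F) : Subgroup G where
  carrier := {g | g.1.onF f = f}
  one_mem' := rfl
  mul_mem' {g h} (hg : g.1.onF f = f) (hh : h.1.onF f = f) := by
    change h.1.onF (g.1.onF f) = f
    rw [hg, hh]
  inv_mem' {g} (hg : g.1.onF f = f) := by
    change g.1.onF.symm f = f
    rw [Equiv.symm_apply_eq, hg]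

/-- `S` induces a cyclic group on the set `X` of edges: modulo the elements acting trivially on
`X`, every element of `S` is a power of a single one. -/
def InducesCyclicOn {G : Subgroup M.Aut} (S : Subgroup G) (X : Set E) : Prop :=
  ∃ c ∈ S, ∀ g ∈ S, ∃ k : ℤ, ∀ e ∈ X, g.1.onE e = (c ^ k).1.onE e

/-- `G` is transitive on the arcs `(α, e)`. -/
def IsArcTransitive (G : Subgroup M.Aut) : Prop :=
  ∀ α e α' e', M.incVE α e → M.incVE α' e' → ∃ g ∈ G, g.onV α = α' ∧ g.onE e = e'

/-- `M` is `G`-vertex-rotary: `G` is arc-transitive, and each vertex stabiliser `G_α` induces a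
transitive cyclic group on `E(α)`. -/
def IsVertexRotary (G : Subgroup M.Aut) : Prop :=
  IsArcTransitive G ∧ ∀ α,
    (∀ e ∈ M.edgesAt α, ∀ e' ∈ M.edgesAt α, ∃ g ∈ stabV G α, g.1.onE e = e') ∧
    InducesCyclicOn (stabV G α) (M.edgesAt α)

/-- `M` is `G`-face-rotary: `G` is arc-transitive, and each face stabiliser `G_f` induces a
cyclic group on `E_F(f)`. -/
def IsFaceRotary (G : Subgroup M.Aut) : Prop :=
  IsArcTransitive G ∧ ∀ f, InducesCyclicOn (stabF G f) (M.edgesOf f)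

/-- `M` is `G`-rotary: both `G`-vertex-rotary and `G`-face-rotary. -/
def IsRotary (G : Subgroup M.Aut) : Prop := IsVertexRotary G ∧ IsFaceRotary G

/-- `M` is `G`-bi-rotary: `G`-vertex-rotary but not `G`-face-rotary. -/
def IsBiRotary (G : Subgroup M.Aut) : Prop := IsVertexRotary G ∧ ¬ IsFaceRotary G

end Rotary

end MapConfig

/-! ### Rotary pairs and the two constructions -/

section Constructions

variable {G : Type*} [Group G]

/-- `(a, z)` is a rotary pair for `G`: `G = ⟨a, z⟩`, `a` has finite order, and `z` is an
involution not in `⟨a⟩`. -/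
def IsRotaryPair (a z : G) : Prop :=
  Subgroup.closure {a, z} = ⊤ ∧ IsOfFinOrder a ∧ orderOf z = 2 ∧ z ∉ Subgroup.zpowers a

/-- The standing conditions of both constructions: `(a, z)` is a rotary pair such that
`H = ⟨a⟩` has order at least three and differs from `H ^ z = ⟨z⁻¹ a z⟩`. -/
def IsNondegeneratePair (a z : G) : Prop :=
  IsRotaryPair a z ∧ 3 ≤ orderOf a ∧ Subgroup.zpowers a ≠ Subgroup.zpowers (z⁻¹ * a * z)

/-- `[G : H]`: the set of right cosets `H x` of `H` in `G`. -/
abbrev RightCosets (H : Subgroup G) := Quotient (QuotientGroup.rightRel H)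

/-- The right coset `H x`. -/
abbrev rcoset (H : Subgroup G) (x : G) : RightCosets H := Quotient.mk (QuotientGroup.rightRel H) x

/-- Right multiplication of cosets: `(H x) g = H (x g)`. -/
def RightCosets.mulRight {H : Subgroup G} (c : RightCosets H) (g : G) : RightCosets H :=
  Quotient.map (· * g) (fun x y h => by
    change QuotientGroup.rightRel H x y at h
    change QuotientGroup.rightRel H (x * g) (y * g)
    rw [QuotientGroup.rightRel_apply] at h ⊢
    simpa [mul_assoc] using h) c

/-- Two cosets have non-empty intersection. -/
def CosetsMeet {H K : Subgroup G} (c : RightCosets H) (d : RightCosets K) : Prop :=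
  ∃ x, rcoset H x = c ∧ rcoset K x = d

/-- The arcs of `Cos(G, ⟨a⟩, ⟨z⟩)`. -/
abbrev CosetArc (a z : G) :=
  Arc (RightCosets (Subgroup.zpowers a)) (RightCosets (Subgroup.zpowers z))

/-- The image of an arc sequence under right multiplication by `g`. -/
def seqMulRight {a z : G} (w : List (CosetArc a z)) (g : G) : List (CosetArc a z) :=
  w.map (Arc.map (fun v => v.mulRight g) (fun e => e.mulRight g))

/-- The cycle `C(az) = (e_0, …, e_{m-1})` with `m = |az|` and
`e_i = [⟨a⟩(az)^i, ⟨z⟩(az)^i, ⟨a⟩(az)^{i+1}]`. -/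
noncomputable def rotaCycle (a z : G) : List (CosetArc a z) :=
  (List.range (orderOf (a * z))).map fun i =>
    ⟨rcoset _ ((a * z) ^ i), rcoset _ ((a * z) ^ i), rcoset _ ((a * z) ^ (i + 1))⟩

/-- The element `z z^a`, where `z^a = a⁻¹ z a`. -/
def zza (a z : G) : G := z * (a⁻¹ * z * a)

/-- The cycle `C(zz^a) = (e_0, …, e_{2l-1})` with `l = |zz^a|` and, writing `u = zz^a`,
`e_{2i} = [⟨a⟩zu^i, ⟨z⟩u^i, ⟨a⟩u^i]` and `e_{2i+1} = [⟨a⟩u^i, ⟨z⟩au^i, ⟨a⟩zu^{i+1}]`. -/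
noncomputable def biRoCycle (a z : G) : List (CosetArc a z) :=
  (List.range (orderOf (zza a z))).flatMap fun i =>
    [⟨rcoset _ (z * zza a z ^ i), rcoset _ (zza a z ^ i), rcoset _ (zza a z ^ i)⟩,
     ⟨rcoset _ (zza a z ^ i), rcoset _ (a * zza a z ^ i), rcoset _ (z * zza a z ^ (i + 1))⟩]

/-- `RotaMap(G, a, z)`: vertices, edges and faces are the right cosets of `⟨a⟩`, `⟨z⟩` and
`⟨az⟩`, incidence is non-empty intersection, and the boundary cycle of the face `⟨az⟩g` is
`C(az)g`. -/
noncomputable def RotaMap (a z : G) :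
    MapConfig (RightCosets (Subgroup.zpowers a)) (RightCosets (Subgroup.zpowers z))
      (RightCosets (Subgroup.zpowers (a * z))) where
  incVE := CosetsMeet
  incVF := CosetsMeet
  incEF := CosetsMeet
  boundary c := {w | ∃ g, rcoset _ g = c ∧ w ∈ seqClass (seqMulRight (rotaCycle a z) g)}

/-- The faces of `BiRoMap(G, a, z)`: the (sequence classes of the) cycles `C(zz^a)g`. -/
def BiRoFace (a z : G) :=
  {S : Set (List (CosetArc a z)) // ∃ g, S = seqClass (seqMulRight (biRoCycle a z) g)}

/-- The face `C(zz^a)g`. -/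
noncomputable def biRoFace (a z g : G) : BiRoFace a z :=
  ⟨seqClass (seqMulRight (biRoCycle a z) g), g, rfl⟩

/-- `BiRoMap(G, a, z)`: vertices and edges are the right cosets of `⟨a⟩` and `⟨z⟩`, incident if
they have non-empty intersection; faces are the cycles `C(zz^a)g`, incident with the edges on
them and the ends of these edges, and bounded by themselves. -/
noncomputable def BiRoMap (a z : G) :
    MapConfig (RightCosets (Subgroup.zpowers a)) (RightCosets (Subgroup.zpowers z))
      (BiRoFace a z) where
  incVE := CosetsMeet
  incVF v S := ∃ w ∈ S.1, ∃ p ∈ w, CosetsMeet v p.edge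
  incEF e S := ∃ w ∈ S.1, ∃ p ∈ w, p.edge = e
  boundary S := S.1

end Constructions

/-!
Since `G` is transitive on edges and `M` has at least three faces, connectedness forces the two
sides of an edge to belong to different faces (`MapConfig.twoFaced_of_isArcTransitive`) and a
corner to belong to only one face (`MapConfig.Consecutive.face_unique`). Boundary walks then have
no repeated edges, the edge that follows `e` at `α` on `f` is determined by the flag `(α, e, f)`,
and an automorphism that fixes a flag is trivial (`MapConfig.eq_one_of_fixes_flag`). Hence `G_α`
is a cyclic group acting faithfully, thus regularly, on the edges at `α`. These form a cycle of
length at least three, and a regular cyclic group on such a cycle is generated by a one-step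
rotation, because the only alternative would contain two involutions. This gives `a`; the
involution `z` is the element of `G` that reverses `e`.

Conversely, for any such pair the one-step rotation `a` takes `f` to `f'`, and `z` either
interchanges `f` and `f'` or fixes both. In the first case `az` fixes `f` and moves each arc on its
boundary to the next one. In the second case `z` and `z^a` are reflections of the boundary walk of
`f'` in two consecutive edges, so `zz^a` moves it two steps on. As a walk with prescribed turns is
determined by its first arc (`MapConfig.exists_walk_of_step`), the boundary walk consists of one
orbit of `⟨az⟩` on arcs, respectively of two orbits of `⟨zz^a⟩`. The orbit maps `g ↦ α^g`, `e^g`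
identify vertices and edges with cosets, and carry this walk to `C(az)`, respectively `C(zz^a)`.
-/

/-! ### Small sets, cyclic lists and cyclic groups -/

theorem ENat.exists_ne_ne_of_three_le_card {X : Type*} (hX : 3 ≤ ENat.card X) (x y : X) :
    ∃ h, h ≠ x ∧ h ≠ y := by
  by_contra! hcon
  have h1 : (Set.univ : Set X) ⊆ {x, y} := fun h _ => by
    by_cases hh : h = x
    · exact Or.inl hh
    · exact Or.inr (hcon h hh)
  have h2 := Set.encard_le_encard h1
  rw [Set.encard_univ] at h2
  have h3 : ({x, y} : Set X).encard ≤ 2 := by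
    refine (Set.encard_insert_le _ _).trans ?_
    rw [Set.encard_singleton, one_add_one_eq_two]
  exact absurd (hX.trans (h2.trans h3)) (by norm_num)

theorem Set.eq_of_encard_eq_two {X : Type*} {S : Set X} (hS : S.encard = 2) {a b c : X}
    (ha : a ∈ S) (hb : b ∈ S) (hc : c ∈ S) (hba : b ≠ a) (hca : c ≠ a) : b = c := by
  obtain ⟨x, y, -, rfl⟩ := Set.encard_eq_two.1 hS
  simp only [Set.mem_insert_iff, Set.mem_singleton_iff] at ha hb hc
  grind

theorem Set.exists_ne_of_encard_eq_two {X : Type*} {S : Set X} (hS : S.encard = 2) (a : X) :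
    ∃ b ∈ S, b ≠ a := by
  obtain ⟨x, y, hxy, rfl⟩ := Set.encard_eq_two.1 hS
  by_cases h : x = a
  · exact ⟨y, by simp, fun hy => hxy (h.trans hy.symm)⟩
  · exact ⟨x, by simp, h⟩

theorem Cycle.Chain.reverse {X : Type*} {r : X → X → Prop} {l : List X}
    (h : Cycle.Chain r (l : Cycle X)) : Cycle.Chain (fun a b => r b a) (l.reverse : Cycle X) := by
  cases l with
  | nil => exact Cycle.Chain.nil _
  | cons a l =>
    have h1 : ((a :: l).reverse : Cycle X) = (a :: l.reverse : List X) := by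
      rw [Cycle.coe_eq_coe, List.reverse_cons]
      exact ⟨l.reverse.length, List.rotate_append_length_eq _ _⟩
    rw [h1, Cycle.chain_coe_cons]
    rw [Cycle.chain_coe_cons] at h
    have h2 : a :: (l.reverse ++ [a]) = (a :: (l ++ [a])).reverse := by simp
    rw [h2, List.isChain_reverse]
    exact h

namespace List

/-- A rotation of a list without repetitions is determined by its first entry. -/
theorem IsRotated.eq_of_map_nodup {X Y : Type*} {k : X → Y} {a b : X} {l l' : List X}
    (h : (a :: l) ~r (b :: l')) (hn : ((a :: l).map k).Nodup) (hk : k a = k b) :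
    a :: l = b :: l' := by
  obtain ⟨n, hn', h⟩ := isRotated_iff_mod.1 h
  rcases Nat.eq_or_lt_of_le hn' with rfl | hlt
  · rw [rotate_length] at h
    exact h
  have h1 := head?_rotate (l := a :: l) hlt
  rw [h, head?_cons, getElem?_eq_getElem hlt, Option.some.injEq] at h1
  have h2 : ((a :: l).map k)[n]'(by simpa using hlt) = ((a :: l).map k)[0]'(by simp) := by
    rw [getElem_map, ← h1, ← hk]; simp
  have h3 := (hn.getElem_inj_iff).1 h2
  subst h3
  simpa using h

theorem map_range_two_mul {X : Type*} (s : ℕ → X) (n : ℕ) :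
    (range (2 * n)).map s = (range n).flatMap fun i => [s (2 * i), s (2 * i + 1)] := by
  induction n with
  | zero => rfl
  | succ n ih =>
    rw [show 2 * (n + 1) = 2 * n + 1 + 1 by ring, range_succ, range_succ, range_succ]
    simp [ih]

end List

/-- A cyclic group has at most one involution. -/
theorem Subgroup.eq_of_mem_zpowers_of_sq_eq_one {G : Type*} [Group G] {c x y : G}
    (hx : x ∈ Subgroup.zpowers c) (hy : y ∈ Subgroup.zpowers c) (hx2 : x * x = 1)
    (hy2 : y * y = 1) (hx1 : x ≠ 1) (hy1 : y ≠ 1) : x = y := by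
  obtain ⟨k, rfl⟩ := hx
  obtain ⟨l, rfl⟩ := hy
  simp only [← zpow_add, ← orderOf_dvd_iff_zpow_eq_one, ne_eq] at hx2 hy2 hx1 hy1 ⊢
  obtain ⟨s, hs⟩ := hx2
  obtain ⟨t, ht⟩ := hy2
  have odd : ∀ {k s : ℤ}, k + k = orderOf c * s → ¬ (orderOf c : ℤ) ∣ k → s % 2 = 1 := by
    intro k s h1 h2
    by_contra h3
    obtain ⟨r, rfl⟩ : (2 : ℤ) ∣ s := by omega
    exact h2 ⟨r, by linarith⟩
  have h1 := odd hs hx1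
  have h2 := odd ht hy1
  obtain ⟨r, hr⟩ : (2 : ℤ) ∣ s - t := by omega
  have : c ^ (k - l) = 1 := by
    rw [← orderOf_dvd_iff_zpow_eq_one]
    have : s = t + 2 * r := by omega
    subst this
    exact ⟨r, by linarith⟩
  rwa [zpow_sub, mul_inv_eq_one] at this

/-! ### Sequence classes of arcs -/

namespace Arc

variable {V E V' E' : Type*}

theorem map_injective {φ : V → V'} {ψ : E → E'} (hφ : φ.Injective) (hψ : ψ.Injective) :
    (Arc.map φ ψ).Injective := by
  intro p q h
  simp only [Arc.map, Arc.mk.injEq] at h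
  exact Arc.ext (hφ h.1) (hψ h.2.1) (hφ h.2.2)

/-- The same walk in the opposite direction. -/
def revWalk (w : List (Arc V E)) : List (Arc V E) := (w.map rev).reverse

theorem revWalk_revWalk (w : List (Arc V E)) : revWalk (revWalk w) = w := by
  have : (rev ∘ rev : Arc V E → Arc V E) = id := rfl
  simp [revWalk, List.map_reverse, this]

theorem mem_revWalk {w : List (Arc V E)} {p : Arc V E} : p ∈ revWalk w ↔ p.rev ∈ w := by
  simp only [revWalk, List.mem_reverse, List.mem_map]
  exact ⟨fun ⟨q, hq, h⟩ => by rw [← h]; exact hq, fun h => ⟨_, h, rfl⟩⟩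

theorem map_edge_revWalk (w : List (Arc V E)) :
    (revWalk w).map edge = (w.map edge).reverse := by
  simp only [revWalk, List.map_reverse, List.map_map]
  rfl

theorem map_revWalk (φ : V → V') (ψ : E → E') (w : List (Arc V E)) :
    revWalk (w.map (Arc.map φ ψ)) = (revWalk w).map (Arc.map φ ψ) := by
  simp only [revWalk, List.map_reverse, List.map_map]
  rfl

theorem isRotated_revWalk {w w' : List (Arc V E)} (h : w ~r w') : revWalk w ~r revWalk w' :=
  (h.map rev).reverse

end Arc

section SeqEquiv

open Arc

variable {V E V' E' : Type*} {w w' w'' : List (Arc V E)}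

theorem SeqEquiv.refl (w : List (Arc V E)) : SeqEquiv w w := Or.inl (List.IsRotated.refl w)

theorem SeqEquiv.symm (h : SeqEquiv w w') : SeqEquiv w' w := by
  rcases h with h | h
  · exact Or.inl h.symm
  · have h2 := isRotated_revWalk (show revWalk w ~r w' from h)
    rw [revWalk_revWalk] at h2
    exact Or.inr h2.symm

theorem SeqEquiv.trans (h : SeqEquiv w w') (h' : SeqEquiv w' w'') : SeqEquiv w w'' := by
  rcases h with h | h <;> rcases h' with h' | h'
  · exact Or.inl (h.trans h')
  · exact Or.inr ((isRotated_revWalk h).trans h')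
  · exact Or.inr (h.trans h')
  · have h2 := isRotated_revWalk (show revWalk w ~r w' from h)
    rw [revWalk_revWalk] at h2
    exact Or.inl (h2.trans h')

theorem mem_seqClass_self (w : List (Arc V E)) : w ∈ seqClass w := SeqEquiv.refl w

theorem seqClass_eq_of_mem (h : w' ∈ seqClass w) : seqClass w' = seqClass w :=
  Set.ext fun _ => ⟨fun hx => SeqEquiv.trans h hx, fun hx => (SeqEquiv.symm h).trans hx⟩

theorem SeqEquiv.edges_perm (h : SeqEquiv w w') : (w.map edge).Perm (w'.map edge) := by
  rcases h with h | h
  · exact (h.map edge).perm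
  · have h2 := (h.map edge).perm
    rw [show (w.map Arc.rev).reverse = revWalk w from rfl, map_edge_revWalk] at h2
    exact (List.reverse_perm _).symm.trans h2

theorem map_image_seqClass (φ : V → V') (ψ : E → E') (w : List (Arc V E)) :
    List.map (Arc.map φ ψ) '' seqClass w = seqClass (w.map (Arc.map φ ψ)) := by
  have key : ∀ u w' : List (Arc V E), ∀ v, u ~r w' → w'.map (Arc.map φ ψ) ~r v →
      ∃ x, u ~r x ∧ x.map (Arc.map φ ψ) = v := by
    rintro u w' v h ⟨n, rfl⟩
    exact ⟨w'.rotate n, h.trans ⟨n, rfl⟩, by rw [List.map_rotate]⟩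
  ext v
  constructor
  · rintro ⟨x, hx | hx, rfl⟩
    · exact Or.inl (hx.map _)
    · refine Or.inr ?_
      have := (show revWalk w ~r x from hx).map (Arc.map φ ψ)
      rwa [← map_revWalk] at this
  · rintro (hv | hv)
    · obtain ⟨x, hx, rfl⟩ := key w w v (List.IsRotated.refl _) hv
      exact ⟨x, Or.inl hx, rfl⟩
    · rw [show ((w.map (Arc.map φ ψ)).map Arc.rev).reverse
        = revWalk (w.map (Arc.map φ ψ)) from rfl, map_revWalk] at hv
      obtain ⟨x, hx, rfl⟩ := key (revWalk w) _ v (List.IsRotated.refl _) hv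
      exact ⟨x, Or.inr hx, rfl⟩

end SeqEquiv

namespace MapConfig

open Arc

variable {V E F : Type*} {M : MapConfig V E F}

/-! ### Arcs, boundary walks and corners of a map -/

theorem IsArc.rev {p : Arc V E} (h : M.IsArc p) : M.IsArc p.rev := ⟨h.1.symm, h.2.2, h.2.1⟩

theorem IsArc.eq_or_eq_rev (hM : M.IsLocallyFiniteMap) {p q : Arc V E} (hp : M.IsArc p)
    (hq : M.IsArc q) (h : p.edge = q.edge) : q = p ∨ q = p.rev := by
  have h2 := hM.two_ends p.edge
  obtain ⟨hq1, hq2, hq3⟩ := hq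
  rw [← h] at hq2 hq3
  by_cases hs : q.src = p.src
  · refine Or.inl (Arc.ext hs h.symm ?_)
    exact Set.eq_of_encard_eq_two h2 hp.2.1 hq3 hp.2.2 (fun h => hq1 (hs.trans h.symm)) hp.1.symm
  · have hs' : q.src = p.tgt := Set.eq_of_encard_eq_two h2 hp.2.1 hq2 hp.2.2 hs hp.1.symm
    refine Or.inr (Arc.ext hs' h.symm ?_)
    exact Set.eq_of_encard_eq_two h2 hp.2.2 hq3 hp.2.1 (fun h => hq1 (hs'.trans h.symm)) hp.1

theorem exists_isArc (hM : M.IsLocallyFiniteMap) {α : V} {x : E} (h : M.incVE α x) :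
    ∃ β, M.IsArc ⟨α, x, β⟩ := by
  obtain ⟨β, hβ, hne⟩ := Set.exists_ne_of_encard_eq_two (hM.two_ends x) α
  exact ⟨β, hne.symm, h, hβ⟩

theorem exists_incVE (hM : M.IsLocallyFiniteMap) (x : E) : ∃ α, M.incVE α x := by
  obtain ⟨a, b, -, h⟩ := Set.encard_eq_two.1 (hM.two_ends x)
  exact ⟨a, (Set.ext_iff.1 h a).2 (Or.inl rfl)⟩

theorem IsClosedWalk.of_isRotated {w w' : List (Arc V E)} (h : M.IsClosedWalk w) (hr : w ~r w') :
    M.IsClosedWalk w' := by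
  refine ⟨fun h' => h.1 ?_, fun p hp => h.2.1 p (hr.mem_iff.2 hp), ?_⟩
  · subst h'
    exact List.isRotated_nil_iff.1 hr
  · rw [← Cycle.coe_eq_coe.2 hr]
    exact h.2.2

theorem IsClosedWalk.revWalk {w : List (Arc V E)} (h : M.IsClosedWalk w) :
    M.IsClosedWalk (revWalk w) := by
  refine ⟨by simpa [Arc.revWalk] using h.1, fun p hp => (h.2.1 _ (mem_revWalk.1 hp)).rev, ?_⟩
  refine Cycle.Chain.reverse (r := fun q p => p.tgt = q.src) (l := w.map Arc.rev) ?_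
  rw [← Cycle.map_coe, Cycle.chain_map]
  exact h.2.2.imp fun a b hab => hab.symm

theorem IsClosedWalk.of_mem_seqClass {w w' : List (Arc V E)} (h : M.IsClosedWalk w)
    (hr : w' ∈ seqClass w) : M.IsClosedWalk w' := by
  rcases hr with hr | hr
  · exact h.of_isRotated hr
  · exact h.revWalk.of_isRotated hr

theorem IsClosedWalk.exists_cons {p : Arc V E} {l : List (Arc V E)}
    (h : M.IsClosedWalk (p :: l)) : ∃ q l', l = q :: l' ∧ p.tgt = q.src := by
  have h1 := h.2.2
  rw [Cycle.chain_coe_cons] at h1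
  cases l with
  | nil =>
    simp only [List.nil_append, List.isChain_pair] at h1
    exact absurd h1.symm (h.2.1 p (by simp)).1
  | cons q l' =>
    rw [List.cons_append, List.isChain_cons_cons] at h1
    exact ⟨q, l', rfl, h1.1⟩

section Boundary

variable (hM : M.IsLocallyFiniteMap)
include hM

theorem exists_mem_boundary (f : F) : ∃ w, w ∈ M.boundary f := by
  obtain ⟨w, hw, -⟩ := hM.boundary_walks
  exact ⟨w f, by rw [(hw f).2]; exact mem_seqClass_self _⟩

theorem boundary_eq_seqClass {f : F} {w : List (Arc V E)} (hw : w ∈ M.boundary f) :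
    M.boundary f = seqClass w := by
  obtain ⟨w', hw', -⟩ := hM.boundary_walks
  rw [(hw' f).2] at hw ⊢
  exact (seqClass_eq_of_mem hw).symm

theorem isClosedWalk_of_mem_boundary {f : F} {w : List (Arc V E)} (hw : w ∈ M.boundary f) :
    M.IsClosedWalk w := by
  obtain ⟨w', hw', -⟩ := hM.boundary_walks
  rw [(hw' f).2] at hw
  exact (hw' f).1.of_mem_seqClass hw

theorem mem_boundary_of_isRotated {f : F} {w w' : List (Arc V E)} (hw : w ∈ M.boundary f)
    (h : w ~r w') : w' ∈ M.boundary f := by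
  rw [boundary_eq_seqClass hM hw]
  exact Or.inl h

theorem revWalk_mem_boundary {f : F} {w : List (Arc V E)} (hw : w ∈ M.boundary f) :
    revWalk w ∈ M.boundary f := by
  rw [boundary_eq_seqClass hM hw]
  exact Or.inr (List.IsRotated.refl _)

theorem incEF_iff_of_mem_boundary {f : F} {w : List (Arc V E)} (hw : w ∈ M.boundary f) {x : E} :
    M.incEF x f ↔ x ∈ w.map Arc.edge := by
  rw [hM.incEF_iff, List.mem_map]
  constructor
  · rintro ⟨w', hw', h⟩
    rw [boundary_eq_seqClass hM hw] at hw'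
    rw [← List.mem_map] at h ⊢
    exact (SeqEquiv.edges_perm hw').mem_iff.2 h
  · exact fun h => ⟨w, hw, h⟩

theorem exists_incEF (f : F) : ∃ x, M.incEF x f := by
  obtain ⟨w, hw⟩ := exists_mem_boundary hM f
  obtain ⟨p, hp⟩ := List.exists_mem_of_ne_nil _ (isClosedWalk_of_mem_boundary hM hw).1
  exact ⟨p.edge, (incEF_iff_of_mem_boundary hM hw).2 (List.mem_map_of_mem hp)⟩

theorem exists_incEF_of_edge (x : E) : ∃ f, M.incEF x f := by
  obtain ⟨w, hw, hx⟩ := hM.boundary_walks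
  obtain ⟨p, q, -, h⟩ := Set.encard_eq_two.1 (hx x)
  have hp : p ∈ {p : F × ℕ | ((w p.1)[p.2]?).map Arc.edge = some x} := by rw [h]; simp
  refine ⟨p.1, (incEF_iff_of_mem_boundary hM (w := w p.1) ?_).2 ?_⟩
  · rw [(hw _).2]; exact mem_seqClass_self _
  · obtain ⟨a, ha, hax⟩ := Option.map_eq_some_iff.1 hp
    exact List.mem_map.2 ⟨a, List.mem_of_getElem? ha, hax⟩

/-- The boundary walk of a face can be started with any prescribed arc along one of its edges. -/
theorem exists_cons_mem_boundary {f : F} {p : Arc V E} (hp : M.IsArc p)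
    (hf : M.incEF p.edge f) : ∃ l, p :: l ∈ M.boundary f := by
  have key : ∀ w ∈ M.boundary f, p ∈ w → ∃ l, p :: l ∈ M.boundary f := by
    intro w hw hpw
    obtain ⟨s, t, rfl⟩ := List.append_of_mem hpw
    exact ⟨t ++ s, mem_boundary_of_isRotated hM hw ⟨s.length, by
      simp [List.rotate_append_length_eq]⟩⟩
  obtain ⟨w, hw⟩ := exists_mem_boundary hM f
  obtain ⟨q, hq, hqp⟩ := List.mem_map.1 ((incEF_iff_of_mem_boundary hM hw).1 hf)
  rcases IsArc.eq_or_eq_rev hM ((isClosedWalk_of_mem_boundary hM hw).2.1 q hq) hp hqp with h | h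
  · exact key w hw (h ▸ hq)
  · exact key _ (revWalk_mem_boundary hM hw) (mem_revWalk.2 (by rw [h]; exact hq))

theorem incVF_iff_exists_incVE {α : V} {f : F} :
    M.incVF α f ↔ ∃ x, M.incVE α x ∧ M.incEF x f := by
  rw [hM.incVF_iff]
  constructor
  · rintro ⟨w, hw, p, hp, rfl⟩
    exact ⟨p.edge, ((isClosedWalk_of_mem_boundary hM hw).2.1 p hp).2.1,
      (incEF_iff_of_mem_boundary hM hw).2 (List.mem_map_of_mem hp)⟩
  · rintro ⟨x, hx, hxf⟩
    obtain ⟨β, hβ⟩ := exists_isArc hM hx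
    obtain ⟨l, hl⟩ := exists_cons_mem_boundary hM hβ hxf
    exact ⟨_, hl, _, List.mem_cons_self, rfl⟩

theorem exists_consecutive {f : F} {p : Arc V E} (hp : M.IsArc p) (hf : M.incEF p.edge f) :
    ∃ x, M.Consecutive f p.tgt p.edge x := by
  obtain ⟨l, hl⟩ := exists_cons_mem_boundary hM hp hf
  obtain ⟨q, l', rfl, h⟩ := (isClosedWalk_of_mem_boundary hM hl).exists_cons
  refine ⟨q.edge, p.src, q.tgt, l', ?_⟩
  rw [show (⟨p.tgt, q.edge, q.tgt⟩ : Arc V E) = q by rw [h]]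
  exact hl

theorem exists_consecutive' {f : F} {α : V} {x : E} (hα : M.incVE α x) (hf : M.incEF x f) :
    ∃ y, M.Consecutive f α x y := by
  obtain ⟨β, hβ⟩ := exists_isArc hM hα
  exact exists_consecutive hM hβ.rev hf

variable {f : F} {α : V} {x y y' : E}

theorem Consecutive.symm (h : M.Consecutive f α x y) : M.Consecutive f α y x := by
  obtain ⟨β, γ, l, h⟩ := h
  refine ⟨γ, β, revWalk l, mem_boundary_of_isRotated hM (revWalk_mem_boundary hM h) ?_⟩
  refine ⟨(revWalk l).length, ?_⟩
  rw [show revWalk ((⟨β, x, α⟩ :: ⟨α, y, γ⟩ :: l : List (Arc V E)))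
    = revWalk l ++ [⟨γ, y, α⟩, ⟨α, x, β⟩] by simp [revWalk, Arc.rev]]
  exact List.rotate_append_length_eq _ _

theorem Consecutive.incEF_left (h : M.Consecutive f α x y) : M.incEF x f := by
  obtain ⟨β, γ, l, h⟩ := h
  exact (incEF_iff_of_mem_boundary hM h).2 (by simp)

theorem Consecutive.incEF_right (h : M.Consecutive f α x y) : M.incEF y f :=
  (h.symm hM).incEF_left hM

theorem Consecutive.incVE_right (h : M.Consecutive f α x y) : M.incVE α y := by
  obtain ⟨β, γ, l, h⟩ := h
  exact ((isClosedWalk_of_mem_boundary hM h).2.1 ⟨α, y, γ⟩ (by simp)).2.1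

theorem Consecutive.incVE_left (h : M.Consecutive f α x y) : M.incVE α x :=
  (h.symm hM).incVE_right hM

theorem exists_edge_at (β : V) : ∃ x, M.incVE β x := by
  obtain ⟨x⟩ := hM.nonempty
  obtain ⟨α, hα⟩ := exists_incVE hM x
  rcases Relation.ReflTransGen.cases_tail (hM.connected α β) with h | ⟨γ, -, -, y, -, hy⟩
  · exact ⟨x, h ▸ hα⟩
  · exact ⟨y, hy⟩

/-- A property of edges that passes from one edge of each corner to the other, and holds
somewhere, holds everywhere: the links and the graph are connected. -/
theorem edge_induction {P : E → Prop} {x₀ : E} (h₀ : P x₀)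
    (step : ∀ f α x y, M.Consecutive f α x y → P x → P y) (x : E) : P x := by
  have link : ∀ α x y, M.incVE α x → M.incVE α y → P x → P y := by
    intro α x y hx hy hP
    induction hM.link_connected α x hx y hy with
    | refl => exact hP
    | tail _ h ih =>
      obtain ⟨f, h⟩ := h
      exact step f α _ _ h (ih (h.incVE_left hM))
  obtain ⟨α, hα⟩ := exists_incVE hM x₀
  obtain ⟨β, hβ⟩ := exists_incVE hM x
  have all : ∀ β, Relation.ReflTransGen M.Adj α β → ∀ y, M.incVE β y → P y := by
    intro β h
    induction h with
    | refl => exact fun y hy => link α x₀ y hα hy h₀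
    | tail _ h ih =>
      obtain ⟨-, z, hz, hz'⟩ := h
      exact fun y hy => link _ z y hz' hy (ih z hz)
  exact all β (hM.connected α β) x hβ

end Boundary

/-! ### Automorphisms -/

section Aut

@[simp] theorem mul_onV (g h : M.Aut) (α : V) : (g * h).onV α = h.onV (g.onV α) := rfl
@[simp] theorem mul_onE (g h : M.Aut) (x : E) : (g * h).onE x = h.onE (g.onE x) := rfl
@[simp] theorem mul_onF (g h : M.Aut) (f : F) : (g * h).onF f = h.onF (g.onF f) := rfl
@[simp] theorem one_onV (α : V) : (1 : M.Aut).onV α = α := rfl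
@[simp] theorem one_onE (x : E) : (1 : M.Aut).onE x = x := rfl
@[simp] theorem one_onF (f : F) : (1 : M.Aut).onF f = f := rfl
@[simp] theorem inv_onV_onV (g : M.Aut) (α : V) : g⁻¹.onV (g.onV α) = α :=
  g.onV.symm_apply_apply α
@[simp] theorem onV_inv_onV (g : M.Aut) (α : V) : g.onV (g⁻¹.onV α) = α :=
  g.onV.apply_symm_apply α
@[simp] theorem inv_onE_onE (g : M.Aut) (x : E) : g⁻¹.onE (g.onE x) = x :=
  g.onE.symm_apply_apply x
@[simp] theorem onE_inv_onE (g : M.Aut) (x : E) : g.onE (g⁻¹.onE x) = x :=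
  g.onE.apply_symm_apply x
@[simp] theorem inv_onF_onF (g : M.Aut) (f : F) : g⁻¹.onF (g.onF f) = f :=
  g.onF.symm_apply_apply f
theorem inv_onV_eq_iff {g : M.Aut} {α β : V} : g⁻¹.onV α = β ↔ α = g.onV β :=
  g.onV.symm_apply_eq
theorem inv_onE_eq_iff {g : M.Aut} {x y : E} : g⁻¹.onE x = y ↔ x = g.onE y :=
  g.onE.symm_apply_eq
theorem inv_onF_eq_iff {g : M.Aut} {f h : F} : g⁻¹.onF f = h ↔ f = g.onF h :=
  g.onF.symm_apply_eq

theorem Consecutive.map {f : F} {α : V} {x y : E} (h : M.Consecutive f α x y) (g : M.Aut) :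
    M.Consecutive (g.onF f) (g.onV α) (g.onE x) (g.onE y) := by
  obtain ⟨β, γ, l, h⟩ := h
  refine ⟨g.onV β, g.onV γ, l.map (Arc.map g.onV g.onE), ?_⟩
  rw [g.boundary_eq]
  exact ⟨_, h, rfl⟩

theorem IsArc.map {p : Arc V E} (h : M.IsArc p) (g : M.Aut) :
    M.IsArc (p.map g.onV g.onE) :=
  ⟨fun h' => h.1 (g.onV.injective h'), (g.incVE_iff _ _).2 h.2.1, (g.incVE_iff _ _).2 h.2.2⟩

end Aut

/-! ### The two faces at an edge, and flags -/

section TwoFaces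

/-- Every edge is incident with exactly two faces. For a map this says that the two sides of an
edge never belong to the same face. -/
def TwoFaced (M : MapConfig V E F) : Prop := ∀ x, {h | M.incEF x h}.encard = 2

theorem eq_or_eq_of_incEF (h2 : M.TwoFaced) {x : E} {f f' h : F} (hne : f ≠ f')
    (hf : M.incEF x f) (hf' : M.incEF x f') (hh : M.incEF x h) : h = f ∨ h = f' := by
  by_cases e : h = f
  · exact Or.inl e
  · exact Or.inr (Set.eq_of_encard_eq_two (h2 x) hf hh hf' e hne.symm)

variable (hM : M.IsLocallyFiniteMap)
include hM

theorem exists_onE_eq {G : Subgroup M.Aut} (hG : IsArcTransitive G) (x y : E) :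
    ∃ g ∈ G, g.onE x = y := by
  obtain ⟨α, hα⟩ := exists_incVE hM x
  obtain ⟨β, hβ⟩ := exists_incVE hM y
  obtain ⟨g, hg, -, h⟩ := hG _ _ _ _ hα hβ
  exact ⟨g, hg, h⟩

/-- If an edge were on both of its sides incident with the same face, then the same would hold
for every edge, whence the map would have only one face by connectedness. -/
theorem twoFaced_of_isArcTransitive (hF : 3 ≤ ENat.card F) {G : Subgroup M.Aut}
    (hG : IsArcTransitive G) : M.TwoFaced := by
  intro x
  have two : ∃ f f', f ≠ f' ∧ M.incEF x f ∧ M.incEF x f' := by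
    by_contra! hcon
    obtain ⟨f₀, hf₀⟩ := exists_incEF_of_edge hM x
    have uniq : ∀ y h h', M.incEF y h → M.incEF y h' → h = h' := by
      intro y h h' hy hy'
      obtain ⟨g, -, hg⟩ := exists_onE_eq hM hG y x
      by_contra hne
      refine hcon (g.onF h) (g.onF h') (fun h => hne (g.onF.injective h)) ?_ ?_
      · rw [← hg]; exact (g.incEF_iff _ _).2 hy
      · rw [← hg]; exact (g.incEF_iff _ _).2 hy'
    have all := edge_induction hM (P := fun y => M.incEF y f₀) hf₀ (by
      intro f α y y' hc hy
      rw [uniq y f₀ f hy (hc.incEF_left hM)]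
      exact hc.incEF_right hM)
    obtain ⟨h, hh, -⟩ := ENat.exists_ne_ne_of_three_le_card hF f₀ f₀
    obtain ⟨y, hy⟩ := exists_incEF hM h
    exact hh (uniq y _ _ hy (all y))
  obtain ⟨w, hw, hcard⟩ := hM.boundary_walks
  obtain ⟨p, q, -, hpq⟩ := Set.encard_eq_two.1 (hcard x)
  have sub : ∀ f, M.incEF x f → f = p.1 ∨ f = q.1 := by
    intro f hf
    rw [incEF_iff_of_mem_boundary hM (w := w f) (by rw [(hw f).2]; exact mem_seqClass_self _),
      List.mem_map] at hf
    obtain ⟨r, hr, hrx⟩ := hf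
    obtain ⟨i, hi⟩ := List.getElem?_of_mem hr
    have : (f, i) ∈ {p : F × ℕ | ((w p.1)[p.2]?).map Arc.edge = some x} := by simp [hi, hrx]
    rw [hpq] at this
    rcases this with rfl | h
    · exact Or.inl rfl
    · exact Or.inr (congrArg Prod.fst h)
  obtain ⟨f, f', hne, hf, hf'⟩ := two
  refine Set.encard_eq_two.2 ⟨f, f', hne, Set.ext fun h => ⟨fun hh => ?_, ?_⟩⟩
  · rcases sub f hf with h1 | h1 <;> rcases sub f' hf' with h2 | h2 <;>
      rcases sub h hh with h3 | h3 <;> simp_all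
  · rintro (rfl | rfl)
    exacts [hf, hf']

variable (h2 : M.TwoFaced)
include h2

/-- A boundary walk passes along each of its edges only once. -/
theorem edges_nodup {f : F} {w : List (Arc V E)} (hw : w ∈ M.boundary f) :
    (w.map Arc.edge).Nodup := by
  obtain ⟨w', hw', hcard⟩ := hM.boundary_walks
  have hwf : ∀ h, w' h ∈ M.boundary h := fun h => by
    rw [(hw' h).2]; exact mem_seqClass_self _
  suffices ((w' f).map Arc.edge).Nodup by
    rw [(hw' f).2] at hw
    exact (SeqEquiv.edges_perm hw).nodup_iff.1 this
  rw [List.nodup_iff_injective_getElem]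
  rintro ⟨i, hi⟩ ⟨j, hj⟩ hij
  simp only [List.length_map] at hi hj
  simp only [List.getElem_map] at hij
  set x := (w' f)[i].edge with hx
  have hxf : M.incEF x f :=
    (incEF_iff_of_mem_boundary hM (hwf f)).2 (List.mem_map_of_mem (List.getElem_mem hi))
  -- the second face at the edge occupies one of its two occurrences
  obtain ⟨f', hf', hne⟩ := Set.exists_ne_of_encard_eq_two (h2 x) f
  obtain ⟨r, hr, hrx⟩ := List.mem_map.1 ((incEF_iff_of_mem_boundary hM (hwf f')).1 hf')
  obtain ⟨k, hk⟩ := List.getElem?_of_mem hr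
  have h := Set.eq_of_encard_eq_two (hcard x) (a := (f', k)) (b := (f, i)) (c := (f, j))
    (by simp [hk, hrx]) (by simp [hi, hx]) (by simp [hj, hij])
    (fun h => hne (congrArg Prod.fst h).symm) (fun h => hne (congrArg Prod.fst h).symm)
  simpa using h

variable {f : F} {α : V} {x y y' : E}

/-- The edge that follows `x` at `α` on the boundary of `f` is determined by the flag
`(α, x, f)`. -/
theorem Consecutive.right_unique (h : M.Consecutive f α x y) (h' : M.Consecutive f α x y') :
    y = y' := by
  obtain ⟨β, γ, l, h⟩ := h
  obtain ⟨β', γ', l', h'⟩ := h'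
  have hs := h'
  rw [boundary_eq_seqClass hM h] at hs
  have harc := (isClosedWalk_of_mem_boundary hM h).2.1 ⟨β, x, α⟩ (by simp)
  have harc' := (isClosedWalk_of_mem_boundary hM h').2.1 ⟨β', x, α⟩ (by simp)
  rcases hs with hs | hs
  · have := hs.eq_of_map_nodup (edges_nodup hM h2 h) rfl
    simp only [List.cons.injEq, Arc.mk.injEq] at this
    exact this.2.1.2.1
  · -- both the arc and its reverse would be in a walk without repeated edges
    exfalso
    have h1 : (⟨α, x, β⟩ : Arc V E) ∈ (⟨β', x, α⟩ :: ⟨α, y', γ'⟩ :: l' : List (Arc V E)) := by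
      refine hs.mem_iff.1 (mem_revWalk.2 ?_)
      exact List.mem_cons_self
    have h3 := List.inj_on_of_nodup_map (edges_nodup hM h2 h') h1 List.mem_cons_self rfl
    exact harc'.1 (congrArg Arc.src h3).symm

theorem Consecutive.ne (h : M.Consecutive f α x y) : x ≠ y := by
  rintro rfl
  obtain ⟨β, γ, l, h⟩ := h
  have := edges_nodup hM h2 h
  simp at this

/-- An automorphism is trivial as soon as it fixes a flag. -/
theorem eq_one_of_fixes_flag {g : M.Aut} (hα : M.incVE α x) (hf : M.incEF x f)
    (gα : g.onV α = α) (gx : g.onE x = x) (gf : g.onF f = f) : g = 1 := by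
  have fixV : ∀ {β y}, g.onE y = y → M.incVE β y → g.onV β = β →
      ∀ γ, M.incVE γ y → g.onV γ = γ := by
    intro β y hy hβ gβ γ hγ
    by_cases h : γ = β
    · rw [h, gβ]
    · refine Set.eq_of_encard_eq_two (hM.two_ends y) hβ ?_ hγ ?_ h
      · have := (g.incVE_iff γ y).2 hγ
        rwa [hy] at this
      · exact fun h' => h (g.onV.injective (h'.trans gβ.symm))
  have fixF : ∀ {h y}, g.onE y = y → M.incEF y h → g.onF h = h →
      ∀ k, M.incEF y k → g.onF k = k := by
    intro h y hy hh gh k hk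
    by_cases e : k = h
    · rw [e, gh]
    · refine Set.eq_of_encard_eq_two (h2 y) hh ?_ hk ?_ e
      · have := (g.incEF_iff y k).2 hk
        rwa [hy] at this
      · exact fun h' => e (g.onF.injective (h'.trans gh.symm))
  have all := edge_induction hM (P := fun y => g.onE y = y ∧ (∀ γ, M.incVE γ y → g.onV γ = γ) ∧
      ∀ k, M.incEF y k → g.onF k = k) ⟨gx, fixV gx hα gα, fixF gx hf gf⟩ (by
    rintro k β y z hc ⟨h1, h3, h4⟩
    have gβ := h3 β (hc.incVE_left hM)
    have gk := h4 k (hc.incEF_left hM)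
    have gz : g.onE z = z := by
      have := hc.map g
      rw [gβ, gk, h1] at this
      exact this.right_unique hM h2 hc
    exact ⟨gz, fixV gz (hc.incVE_right hM) gβ, fixF gz (hc.incEF_right hM) gk⟩)
  refine Iso.ext (Equiv.ext fun β => ?_) (Equiv.ext fun y => (all y).1) (Equiv.ext fun k => ?_)
  · obtain ⟨y, hy⟩ := exists_edge_at hM β
    exact (all y).2.1 β hy
  · obtain ⟨y, hy⟩ := exists_incEF hM k
    exact (all y).2.2 k hy

/-- Two faces with a common corner would be the only faces, because by arc-transitivity every
corner would then be common to both. -/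
theorem Consecutive.face_unique (hF : 3 ≤ ENat.card F) {G : Subgroup M.Aut}
    (hG : IsArcTransitive G) {f' : F} (h : M.Consecutive f α x y) (h' : M.Consecutive f' α x y) :
    f = f' := by
  by_contra hne
  have hxf := h.incEF_left hM
  have hxf' := h'.incEF_left hM
  have all := edge_induction hM (P := fun z => M.incEF z f ∧ M.incEF z f') ⟨hxf, hxf'⟩ (by
    rintro k β u v hc ⟨hu, hu'⟩
    -- transport the corner to the given arc, where the neighbouring edge has the same faces
    obtain ⟨g, -, gβ, gu⟩ := hG _ _ _ _ (hc.incVE_left hM) (h.incVE_left hM)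
    have hc' := hc.map g
    rw [gβ, gu] at hc'
    have gv : g.onE v = y := by
      rcases eq_or_eq_of_incEF h2 hne hxf hxf' (hc'.incEF_left hM) with e | e <;> rw [e] at hc'
      · exact hc'.right_unique hM h2 h
      · exact hc'.right_unique hM h2 h'
    have faces : ∀ k, M.incEF u k → M.incEF v k := by
      intro k hk
      rw [← g.incEF_iff, gu] at hk
      rw [← g.incEF_iff, gv]
      rcases eq_or_eq_of_incEF h2 hne hxf hxf' hk with e | e <;> rw [e]
      · exact h.incEF_right hM
      · exact h'.incEF_right hM
    exact ⟨faces _ hu, faces _ hu'⟩)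
  obtain ⟨k, hk, hk'⟩ := ENat.exists_ne_ne_of_three_le_card hF f f'
  obtain ⟨z, hz⟩ := exists_incEF hM k
  rcases eq_or_eq_of_incEF h2 hne (all z).1 (all z).2 hz with e | e
  exacts [hk e, hk' e]

/-- A sequence of arcs that turns at each step into the next edge of the face `f` runs around
the boundary of `f` periodically. -/
theorem exists_walk_of_step {s : ℕ → Arc V E} (harc : ∀ i, M.IsArc (s i))
    (h₀ : M.incEF (s 0).edge f) (htgt : ∀ i, (s i).tgt = (s (i + 1)).src)
    (hstep : ∀ i, M.Consecutive f (s i).tgt (s i).edge (s (i + 1)).edge) :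
    ∃ n, 0 < n ∧ (List.range n).map s ∈ M.boundary f ∧
      (∀ i, (s i).edge = (s 0).edge → n ∣ i) ∧ ∀ i, n ∣ i → s i = s 0 := by
  obtain ⟨l₀, hl₀⟩ := exists_cons_mem_boundary hM (harc 0) h₀
  set w := s 0 :: l₀ with hw
  have rot : ∀ i, ∃ l, w.rotate i = s i :: l := by
    intro i
    induction i with
    | zero => exact ⟨l₀, by simp [hw]⟩
    | succ i ih =>
      obtain ⟨l, hl⟩ := ih
      have hmem : s i :: l ∈ M.boundary f := mem_boundary_of_isRotated hM hl₀ ⟨i, hl⟩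
      have hcw := isClosedWalk_of_mem_boundary hM hmem
      obtain ⟨q, l', rfl, hq⟩ := hcw.exists_cons
      have hqe : q.edge = (s (i + 1)).edge := by
        refine Consecutive.right_unique hM h2 ⟨(s i).src, q.tgt, l', ?_⟩ (hstep i)
        rw [show (⟨(s i).tgt, q.edge, q.tgt⟩ : Arc V E) = q by rw [hq]]
        exact hmem
      have hqs : q = s (i + 1) := by
        rcases IsArc.eq_or_eq_rev hM (harc (i + 1)) (hcw.2.1 q (by simp)) hqe.symm with h | h
        · exact h
        · exfalso
          refine (harc (i + 1)).1 ?_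
          rw [← htgt, hq, h]; rfl
      refine ⟨l' ++ [s i], ?_⟩
      rw [← List.rotate_rotate, hl, hqs]
      simp
  have hget : ∀ i, i < w.length → w[i]? = some (s i) := by
    intro i hi
    obtain ⟨l, hl⟩ := rot i
    rw [← List.head?_rotate hi, hl, List.head?_cons]
  have hmod : ∀ i, s i = s (i % w.length) := by
    intro i
    obtain ⟨l, hl⟩ := rot i
    obtain ⟨l', hl'⟩ := rot (i % w.length)
    rw [List.rotate_mod, hl] at hl'
    exact (List.cons.inj hl').1
  have hpos : 0 < w.length := by simp [hw]
  have hmap : (List.range w.length).map s = w := by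
    refine List.ext_getElem (by simp) fun i h1 h3 => ?_
    have := hget i h3
    rw [List.getElem?_eq_getElem h3, Option.some.injEq] at this
    simp [this]
  refine ⟨w.length, hpos, by rwa [hmap], fun i hi => ?_, fun i hi => ?_⟩
  · rw [hmod i] at hi
    have hlt := Nat.mod_lt i hpos
    have hnd := edges_nodup hM h2 hl₀
    have e1 := hget _ hlt
    have e2 := hget _ hpos
    rw [List.getElem?_eq_getElem hlt, Option.some.injEq] at e1
    rw [List.getElem?_eq_getElem hpos, Option.some.injEq] at e2
    have := (hnd.getElem_inj_iff (hi := by simpa using hlt) (hj := by simpa using hpos)).1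
      (by simp only [List.getElem_map, e1, e2, hi])
    exact Nat.dvd_of_mod_eq_zero this
  · rw [hmod i, Nat.mod_eq_zero_of_dvd hi]

theorem faceLength_eq_length {w : List (Arc V E)} (hw : w ∈ M.boundary f) :
    M.faceLength f = w.length := by
  classical
  have : M.edgesOf f = ((w.map Arc.edge).toFinset : Set E) := by
    ext z
    rw [List.coe_toFinset]
    exact incEF_iff_of_mem_boundary hM hw
  rw [faceLength, this, Set.ncard_coe_finset,
    List.toFinset_card_of_nodup (edges_nodup hM h2 hw), List.length_map]

end TwoFaces

/-! ### Rotary pairs at an arc -/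

theorem mem_stabV {G : Subgroup M.Aut} {α : V} {g : G} : g ∈ stabV G α ↔ g.1.onV α = α := Iff.rfl
theorem mem_stabE {G : Subgroup M.Aut} {x : E} {g : G} : g ∈ stabE G x ↔ g.1.onE x = x := Iff.rfl
theorem mem_stabF {G : Subgroup M.Aut} {f : F} {g : G} : g ∈ stabF G f ↔ g.1.onF f = f := Iff.rfl

/-- The map `M` is locally finite, all its edges are two-faced, and no two different faces have a
corner in common. These are the consequences of `|F| ≥ 3` and arc-transitivity which the
analysis of vertex-rotary maps rests on. -/
structure IsCornerSimple (M : MapConfig V E F) : Prop where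
  isMap : M.IsLocallyFiniteMap
  twoFaced : M.TwoFaced
  face_unique : ∀ {α x y f f'}, M.Consecutive f α x y → M.Consecutive f' α x y → f = f'

theorem isCornerSimple (hM : M.IsLocallyFiniteMap) (hF : 3 ≤ ENat.card F) {G : Subgroup M.Aut}
    (hG : IsArcTransitive G) : M.IsCornerSimple :=
  have h2 := twoFaced_of_isArcTransitive hM hF hG
  ⟨hM, h2, fun h h' => h.face_unique hM h2 hF hG h'⟩

section Existence

variable (hC : M.IsCornerSimple) {G : Subgroup M.Aut} {α : V} {e : E}
include hC

/-- A vertex stabiliser acts faithfully on the edges at the vertex. -/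
theorem eq_one_of_fixes_edgesAt {g : M.Aut} (hαe : M.incVE α e) (gα : g.onV α = α)
    (h : ∀ x, M.incVE α x → g.onE x = x) : g = 1 := by
  obtain ⟨f, hf⟩ := exists_incEF_of_edge hC.isMap e
  obtain ⟨y, hy⟩ := exists_consecutive' hC.isMap hαe hf
  have hg := hy.map g
  rw [gα, h e hαe, h y (hy.incVE_right hC.isMap)] at hg
  exact eq_one_of_fixes_flag hC.isMap hC.twoFaced hαe hf gα (h e hαe)
    (hC.face_unique hg hy)

theorem exists_stabV_eq_zpowers (hG : IsVertexRotary G) (hαe : M.incVE α e) :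
    ∃ c, stabV G α = Subgroup.zpowers c := by
  obtain ⟨c, hc, hgen⟩ := (hG.2 α).2
  refine ⟨c, le_antisymm (fun g hg => ?_) ((Subgroup.zpowers_le).2 hc)⟩
  obtain ⟨k, hk⟩ := hgen g hg
  refine ⟨k, Subtype.ext ?_⟩
  have hck : (c ^ k) ∈ stabV G α := Subgroup.zpow_mem _ hc k
  have : (g * (c ^ k)⁻¹).1 = 1 := by
    refine eq_one_of_fixes_edgesAt hC hαe (mem_stabV.1 (mul_mem hg (inv_mem hck))) ?_
    intro x hx
    simp only [Subgroup.coe_mul, Subgroup.coe_inv, mul_onE]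
    rw [hk x hx, inv_onE_onE]
  have h1 : g * (c ^ k)⁻¹ = 1 := Subtype.ext this
  rw [mul_inv_eq_one.1 h1]

/-- The group of a vertex-rotary map acts regularly on the arcs. -/
theorem eq_one_of_fixes_arc (hG : IsVertexRotary G) (hαe : M.incVE α e) {g : G}
    (gα : g.1.onV α = α) (ge : g.1.onE e = e) : g = 1 := by
  obtain ⟨c, hc⟩ := exists_stabV_eq_zpowers hC hG hαe
  refine Subtype.ext (eq_one_of_fixes_edgesAt hC hαe gα fun x hx => ?_)
  obtain ⟨h, hh, rfl⟩ := (hG.2 α).1 e hαe x hx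
  have hg : g ∈ stabV G α := gα
  rw [hc] at hg hh
  obtain ⟨k, rfl⟩ := hg
  obtain ⟨l, rfl⟩ := hh
  have comm : c ^ l * c ^ k = c ^ k * c ^ l := by rw [← zpow_add, ← zpow_add, add_comm]
  calc (c ^ k).1.onE ((c ^ l).1.onE e) = (c ^ l * c ^ k).1.onE e := rfl
    _ = (c ^ l).1.onE ((c ^ k).1.onE e) := by rw [comm]; rfl
    _ = (c ^ l).1.onE e := congrArg _ ge

/-- Among the elements of `G_α`, the one that rotates an edge at `α` one step generates: its
inverse rotates one step in the other direction, because the alternative would give two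
involutions in the cyclic group `G_α`. -/
theorem exists_stabV_eq_zpowers_of_face (hG : IsVertexRotary G) (hαe : M.incVE α e) {f' : F}
    (hf' : M.incEF e f') :
    ∃ a : G, stabV G α = Subgroup.zpowers a ∧ M.Consecutive f' α e (a.1.onE e) := by
  have hM := hC.isMap
  obtain ⟨f, hf, hne⟩ := Set.exists_ne_of_encard_eq_two (hC.twoFaced e) f'
  have step : ∀ {k}, M.incEF e k → ∃ a ∈ stabV G α, M.Consecutive k α e (a.1.onE e) := by
    intro k hk
    obtain ⟨y, hy⟩ := exists_consecutive' hM hαe hk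
    obtain ⟨a, ha, rfl⟩ := (hG.2 α).1 e hαe y (hy.incVE_right hM)
    exact ⟨a, ha, hy⟩
  obtain ⟨a, ha, hca⟩ := step hf'
  obtain ⟨b, hb, hcb⟩ := step hf
  have regular : ∀ {g h : G}, g ∈ stabV G α → h ∈ stabV G α → g.1.onE e = h.1.onE e → g = h := by
    intro g h hg hh hgh
    refine mul_inv_eq_one.1 (eq_one_of_fixes_arc hC hG hαe (mul_mem hg (inv_mem hh)) ?_)
    simp only [Subgroup.coe_mul, Subgroup.coe_inv, mul_onE, hgh, inv_onE_onE]
  have nbr : ∀ {k y}, M.Consecutive k α e y → y = a.1.onE e ∨ y = b.1.onE e := by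
    intro k y hk
    rcases eq_or_eq_of_incEF hC.twoFaced hne hf hf' (hk.incEF_left hM) with rfl | rfl
    · exact Or.inr (hk.right_unique hM hC.twoFaced hcb)
    · exact Or.inl (hk.right_unique hM hC.twoFaced hca)
  have inv_nbr : ∀ {k} {g : G}, g ∈ stabV G α → M.Consecutive k α e (g.1.onE e) →
      g⁻¹ = a ∨ g⁻¹ = b := by
    intro k g hg hk
    have h1 := (hk.map (g⁻¹).1).symm hM
    have h2 : (g⁻¹).1.onV α = α := inv_mem hg
    rw [h2, Subgroup.coe_inv, inv_onE_onE] at h1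
    rcases nbr h1 with h | h
    · exact Or.inl (regular (inv_mem hg) ha h)
    · exact Or.inr (regular (inv_mem hg) hb h)
  have hab : a ≠ b := fun h => hne (hC.face_unique hcb (h ▸ hca))
  have ne_one : ∀ {k} {g : G}, M.Consecutive k α e (g.1.onE e) → g ≠ 1 := by
    rintro k g hk rfl
    exact hk.ne hM hC.twoFaced rfl
  have hba : b = a⁻¹ := by
    rcases inv_nbr ha hca with h | h
    · exfalso
      rcases inv_nbr hb hcb with h' | h'
      · exact hab (by rw [← h, ← h', inv_inv])
      · obtain ⟨c, hc⟩ := exists_stabV_eq_zpowers hC hG hαe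
        exact hab (Subgroup.eq_of_mem_zpowers_of_sq_eq_one (hc ▸ ha) (hc ▸ hb)
          (by rw [← inv_eq_iff_mul_eq_one.1 h]) (by rw [← inv_eq_iff_mul_eq_one.1 h'])
          (ne_one hca) (ne_one hcb))
    · exact h.symm
  refine ⟨a, le_antisymm (fun g hg => ?_) ((Subgroup.zpowers_le).2 ha), hca⟩
  have reach : ∀ y, M.incVE α y → ∃ h ∈ Subgroup.zpowers a, h.1.onE e = y := by
    intro y hy
    induction hM.link_connected α e hαe y hy with
    | refl => exact ⟨1, one_mem _, rfl⟩
    | tail _ h ih =>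
      obtain ⟨k, hk⟩ := h
      obtain ⟨h, hh, he⟩ := ih (hk.incVE_left hM)
      have hhα : (h⁻¹).1.onV α = α := inv_mem ((Subgroup.zpowers_le).2 ha hh)
      have h1 := hk.map (h⁻¹).1
      rw [hhα, ← he, Subgroup.coe_inv, inv_onE_onE] at h1
      rcases nbr h1 with h2 | h2
      · exact ⟨a * h, mul_mem (Subgroup.mem_zpowers a) hh, (inv_onE_eq_iff.1 h2).symm⟩
      · exact ⟨b * h, mul_mem (hba ▸ inv_mem (Subgroup.mem_zpowers a)) hh,
          (inv_onE_eq_iff.1 h2).symm⟩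
  obtain ⟨h, hh, he⟩ := reach (g.1.onE e) (by
    have := (g.1.incVE_iff α e).2 hαe
    rwa [mem_stabV.1 hg] at this)
  rwa [regular hg ((Subgroup.zpowers_le).2 ha hh) he.symm]

theorem exists_involution (hG : IsVertexRotary G) (hαe : M.incVE α e) :
    ∃ z : G, orderOf z = 2 ∧ stabE G e = Subgroup.zpowers z ∧ z.1.onV α ≠ α := by
  have hM := hC.isMap
  obtain ⟨β, hβ⟩ := exists_isArc hM hαe
  obtain ⟨z, hz, zα, ze⟩ := hG.1 α e β e hαe hβ.2.2
  have swap : ∀ {g : G}, g.1.onE e = e → g.1.onV α ≠ α → g.1.onV α = β := by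
    intro g ge gα
    refine Set.eq_of_encard_eq_two (hM.two_ends e) hαe ?_ hβ.2.2 gα hβ.1.symm
    have := (g.1.incVE_iff α e).2 hαe
    rwa [ge] at this
  have hzz : (⟨z, hz⟩ : G) * ⟨z, hz⟩ = 1 := by
    refine eq_one_of_fixes_arc hC hG hαe ?_ (by simp [ze])
    refine Set.eq_of_encard_eq_two (hM.two_ends e) hβ.2.2 ?_ hαe ?_ hβ.1
    · simp only [Subgroup.coe_mul, mul_onV, zα]
      have := (z.incVE_iff β e).2 hβ.2.2
      rwa [ze] at this
    · simp only [Subgroup.coe_mul, mul_onV]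
      exact fun h => hβ.1 (z.onV.injective (zα.trans (h.symm.trans (by rw [zα]))) )
  have hz1 : (⟨z, hz⟩ : G) ≠ 1 := by
    intro h
    have : z = 1 := congrArg Subtype.val h
    rw [this] at zα
    exact hβ.1 zα
  refine ⟨⟨z, hz⟩, orderOf_eq_prime (by rw [pow_two, hzz]) hz1, le_antisymm (fun g hg => ?_)
    ((Subgroup.zpowers_le).2 ze), fun h => hβ.1 (h.symm.trans zα)⟩
  by_cases gα : g.1.onV α = α
  · rw [eq_one_of_fixes_arc hC hG hαe gα hg]
    exact one_mem _
  · have : g * (⟨z, hz⟩ : G)⁻¹ = 1 := by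
      refine eq_one_of_fixes_arc hC hG hαe ?_ (mul_mem hg (inv_mem (show _ ∈ stabE G e from ze)))
      rw [Subgroup.coe_mul, mul_onV, swap hg gα]
      exact inv_onV_eq_iff.2 zα.symm
    rw [mul_inv_eq_one.1 this]
    exact Subgroup.mem_zpowers _

/-- The neighbours of `α` are the images of `α` under `z` followed by elements of `⟨a⟩`, so by
connectedness `⟨a, z⟩` is transitive on the vertices. -/
theorem closure_pair_eq_top (hG : IsVertexRotary G) (hαe : M.incVE α e) {a z : G}
    (ha : stabV G α = Subgroup.zpowers a) (ze : z.1.onE e = e) (zα : z.1.onV α ≠ α) :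
    Subgroup.closure {a, z} = ⊤ := by
  have hM := hC.isMap
  set H := Subgroup.closure {a, z}
  have haH : stabV G α ≤ H := by
    rw [ha, Subgroup.zpowers_le]
    exact Subgroup.subset_closure (by simp)
  have hzH : z ∈ H := Subgroup.subset_closure (by simp)
  have orbit : ∀ β, ∃ h ∈ H, h.1.onV α = β := by
    intro β
    induction hM.connected α β with
    | refl => exact ⟨1, one_mem _, rfl⟩
    | @tail β γ _ hadj ih =>
      obtain ⟨h, hh, rfl⟩ := ih
      obtain ⟨hne, y, hy, hy'⟩ := hadj
      have hαy : M.incVE α ((h⁻¹).1.onE y) := by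
        rw [← h.1.incVE_iff, Subgroup.coe_inv, onE_inv_onE]; exact hy
      obtain ⟨g, hg, hge⟩ := (hG.2 α).1 e hαe _ hαy
      have hgh : (g * h).1.onE e = y := (inv_onE_eq_iff.1 hge.symm).symm
      refine ⟨z * (g * h), mul_mem hzH (mul_mem (haH hg) hh), ?_⟩
      have e1 : (g * h).1.onV α = h.1.onV α := congrArg h.1.onV hg
      refine Set.eq_of_encard_eq_two (hM.two_ends y) hy ?_ hy' ?_ hne.symm
      · have := ((z * (g * h)).1.incVE_iff α e).2 hαe
        rwa [show (z * (g * h)).1.onE e = (g * h).1.onE (z.1.onE e) from rfl, ze, hgh] at this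
      · rw [← e1]
        exact fun h' => zα ((g * h).1.onV.injective h')
  refine (Subgroup.eq_top_iff' _).2 fun g => ?_
  obtain ⟨h, hh, he⟩ := orbit (g.1.onV α)
  have : g * h⁻¹ ∈ stabV G α := by
    rw [mem_stabV, Subgroup.coe_mul, mul_onV, ← he, Subgroup.coe_inv, inv_onV_onV]
  have := mul_mem (haH this) hh
  rwa [inv_mul_cancel_right] at this

theorem exists_isRotaryPair (hG : IsVertexRotary G) (hαe : M.incVE α e) {f' : F}
    (hf' : M.incEF e f') :
    ∃ a z : G, IsRotaryPair a z ∧ stabV G α = Subgroup.zpowers a ∧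
      stabE G e = Subgroup.zpowers z ∧ M.Consecutive f' α e (a.1.onE e) := by
  obtain ⟨a, ha, hca⟩ := exists_stabV_eq_zpowers_of_face hC hG hαe hf'
  obtain ⟨z, hz2, hz, hzα⟩ := exists_involution hC hG hαe
  have hze : z ∈ stabE G e := hz ▸ Subgroup.mem_zpowers z
  refine ⟨a, z, ⟨closure_pair_eq_top hC hG hαe ha hze hzα, ?_, hz2, fun h => ?_⟩, ha, hz, hca⟩
  · rw [← finite_zpowers, ← ha]
    refine Set.Finite.of_injOn (f := fun g : G => g.1.onE e) (t := M.edgesAt α) ?_ ?_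
      (hC.isMap.finite_edgesAt α)
    · intro g hg
      have := (g.1.incVE_iff α e).2 hαe
      rwa [show g.1.onV α = α from hg] at this
    · intro g hg h hh hgh
      refine mul_inv_eq_one.1 (eq_one_of_fixes_arc hC hG hαe (mul_mem hg (inv_mem hh)) ?_)
      simp only at hgh
      simp only [Subgroup.coe_mul, Subgroup.coe_inv, mul_onE, hgh, inv_onE_onE]
  · rw [← ha] at h
    exact hzα h

end Existence

end MapConfig

/-! ### Right cosets and transitive right actions -/

section Cosets

variable {G : Type*} [Group G] {H : Subgroup G}

theorem rcoset_eq_iff {g h : G} : rcoset H g = rcoset H h ↔ g * h⁻¹ ∈ H := by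
  rw [eq_comm, rcoset, rcoset, Quotient.eq, QuotientGroup.rightRel_apply]

/-- The orbit map of a transitive right action identifies the points with the right cosets of the
stabiliser. -/
theorem exists_equiv_rightCosets {X : Type*} {act : G → X} (hsurj : Function.Surjective act)
    (hact : ∀ g h, act g = act h ↔ g * h⁻¹ ∈ H) :
    ∃ φ : X ≃ RightCosets H, ∀ g, φ (act g) = rcoset H g := by
  have hwd : ∀ g h : G, QuotientGroup.rightRel H g h → act g = act h := fun g h hgh =>
    (hact g h).2 (rcoset_eq_iff.1 (Quotient.sound hgh))
  let ψ : RightCosets H → X := Quotient.lift act hwd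
  have hψ : Function.Bijective ψ := by
    refine ⟨?_, fun x => (hsurj x).imp' (rcoset H) fun g hg => hg⟩
    rintro ⟨g⟩ ⟨h⟩ hgh
    exact rcoset_eq_iff.2 ((hact g h).1 hgh)
  refine ⟨(Equiv.ofBijective ψ hψ).symm, fun g => ?_⟩
  rw [Equiv.symm_apply_eq]
  rfl

end Cosets

namespace MapConfig

open Arc

variable {V E F : Type*} {M : MapConfig V E F}

/-! ### Vertex-rotary maps with a rotary pair -/

/-- The situation at a fixed arc `(α, e)` of a vertex-rotary map: `f` and `f'` are the two faces
at `e`, the generator `a` of `G_α` rotates one step across `f'`, and `z` generates `G_e`. -/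
structure IsRotaryFrame (G : Subgroup M.Aut) (α : V) (e : E) (f f' : F) (a z : G) : Prop where
  cornerSimple : M.IsCornerSimple
  isVertexRotary : IsVertexRotary G
  ne : f ≠ f'
  incVE : M.incVE α e
  incEF : M.incEF e f
  incEF' : M.incEF e f'
  isRotaryPair : IsRotaryPair a z
  stabV_eq : stabV G α = Subgroup.zpowers a
  stabE_eq : stabE G e = Subgroup.zpowers z
  corner : M.Consecutive f' α e (a.1.onE e)

namespace IsRotaryFrame

variable {G : Subgroup M.Aut} {α : V} {e : E} {f f' : F} {a z : G}
  (h : IsRotaryFrame G α e f f' a z)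
include h

theorem isMap : M.IsLocallyFiniteMap := h.cornerSimple.isMap

theorem twoFaced : M.TwoFaced := h.cornerSimple.twoFaced

theorem z_mul_z : z * z = 1 := by
  rw [← pow_two, ← h.isRotaryPair.2.2.1, pow_orderOf_eq_one]

theorem z_ne_one : z ≠ 1 := by
  intro hz
  have := h.isRotaryPair.2.2.1
  rw [hz, orderOf_one] at this
  exact absurd this (by decide)

theorem a_vertex : a.1.onV α = α := by
  rw [← mem_stabV, h.stabV_eq]
  exact Subgroup.mem_zpowers a

theorem z_edge : z.1.onE e = e := by
  rw [← mem_stabE, h.stabE_eq]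
  exact Subgroup.mem_zpowers z

theorem z_vertex_ne : z.1.onV α ≠ α := by
  rw [Ne, ← mem_stabV, h.stabV_eq]
  exact h.isRotaryPair.2.2.2

theorem isArc : M.IsArc ⟨α, e, z.1.onV α⟩ := by
  refine ⟨h.z_vertex_ne.symm, h.incVE, ?_⟩
  have := (z.1.incVE_iff α e).2 h.incVE
  rwa [h.z_edge] at this

theorem eq_one_or_eq_z {g : G} (hg : g.1.onE e = e) : g = 1 ∨ g = z := by
  have : g ∈ Subgroup.zpowers z := h.stabE_eq ▸ mem_stabE.2 hg
  obtain ⟨k, rfl⟩ := this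
  rcases Int.even_or_odd' k with ⟨l, rfl | rfl⟩
  · left; simp [zpow_mul, pow_two, h.z_mul_z, zpow_ofNat]
  · right; simp [zpow_add, zpow_mul, pow_two, h.z_mul_z, zpow_ofNat]

theorem eq_one_of_arc {g : G} (hα : g.1.onV α = α) (he : g.1.onE e = e) : g = 1 :=
  (h.eq_one_or_eq_z he).resolve_right fun hz => h.z_vertex_ne (hz ▸ hα)

theorem exists_arc {β : V} {y : E} (hy : M.incVE β y) : ∃ g : G, g.1.onV α = β ∧ g.1.onE e = y := by
  obtain ⟨g, hg, h1, h2⟩ := h.isVertexRotary.1 _ _ _ _ h.incVE hy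
  exact ⟨⟨g, hg⟩, h1, h2⟩

theorem exists_vertex (β : V) : ∃ g : G, g.1.onV α = β := by
  obtain ⟨y, hy⟩ := exists_edge_at h.isMap β
  obtain ⟨g, hg, -⟩ := h.exists_arc hy
  exact ⟨g, hg⟩

theorem exists_edge (y : E) : ∃ g : G, g.1.onE e = y := by
  obtain ⟨β, hβ⟩ := exists_incVE h.isMap y
  obtain ⟨g, -, hg⟩ := h.exists_arc hβ
  exact ⟨g, hg⟩

theorem face_eq {g : G} {k : F} (hk : M.incEF (g.1.onE e) k) :
    k = g.1.onF f ∨ k = g.1.onF f' :=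
  eq_or_eq_of_incEF h.twoFaced (fun hh => h.ne (g.1.onF.injective hh))
    ((g.1.incEF_iff _ _).2 h.incEF) ((g.1.incEF_iff _ _).2 h.incEF') hk

theorem z_face : (z.1.onF f = f' ∧ z.1.onF f' = f) ∨ (z.1.onF f = f ∧ z.1.onF f' = f') := by
  have perm : ∀ {k}, M.incEF e k → z.1.onF k = f ∨ z.1.onF k = f' := by
    intro k hk
    refine eq_or_eq_of_incEF h.twoFaced h.ne h.incEF h.incEF' ?_
    have := (z.1.incEF_iff e k).2 hk
    rwa [h.z_edge] at this
  rcases perm h.incEF with h1 | h1 <;> rcases perm h.incEF' with h2 | h2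
  · exact absurd (z.1.onF.injective (h1.trans h2.symm)) h.ne
  · exact Or.inr ⟨h1, h2⟩
  · exact Or.inl ⟨h1, h2⟩
  · exact absurd (z.1.onF.injective (h1.trans h2.symm)) h.ne

/-- The corners at `e` across `f` and `f'` end in different edges, so `α` has at least three
edges. -/
theorem three_le_orderOf : 3 ≤ orderOf a := by
  have hpos := h.isRotaryPair.2.1.orderOf_pos
  by_contra hlt
  have haa : a * a = 1 := by
    have h12 : orderOf a = 1 ∨ orderOf a = 2 := by omega
    rcases h12 with h1 | h1
    · rw [orderOf_eq_one_iff.1 h1, one_mul]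
    · rw [← pow_two, ← h1, pow_orderOf_eq_one]
  obtain ⟨y, hy⟩ := exists_consecutive' h.isMap h.incVE h.incEF
  obtain ⟨g, hg, rfl⟩ := (h.isVertexRotary.2 α).1 e h.incVE y (hy.incVE_right h.isMap)
  rw [h.stabV_eq] at hg
  obtain ⟨k, rfl⟩ := hg
  rcases Int.even_or_odd' k with ⟨l, rfl | rfl⟩
  · have h1 : a ^ (2 * l) = 1 := by simp [zpow_mul, pow_two, haa, zpow_ofNat]
    simp only [h1] at hy
    exact hy.ne h.isMap h.twoFaced rfl
  · have h1 : a ^ (2 * l + 1) = a := by simp [zpow_add, zpow_mul, pow_two, haa, zpow_ofNat]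
    simp only [h1] at hy
    exact h.ne (h.cornerSimple.face_unique hy h.corner)

/-- If `a` fixed `f'`, it would map the corner of `f'` at `α` from `e` to `e ^ a` to itself, and
hence be an involution. -/
theorem a_face : a.1.onF f = f' := by
  have hM := h.isMap
  rcases h.face_eq (h.corner.incEF_right hM) with h1 | h1
  · exact h1.symm
  exfalso
  have h3 := h.corner.map a.1
  rw [h.a_vertex, ← h1] at h3
  have h4 := (h.corner.symm hM).right_unique hM h.twoFaced h3
  have : a * a = 1 := h.eq_one_of_arc (by simp [h.a_vertex]) (by simpa using h4.symm)
  have h5 : orderOf a ≤ 2 := orderOf_le_of_pow_eq_one (by norm_num) (by rw [pow_two, this])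
  have h6 := h.three_le_orderOf
  omega

/-- If `a` generated the stabilisers of both ends of `e`, the two ends of `e` would be the only
vertices. -/
theorem isNondegeneratePair (hV : 3 ≤ ENat.card V) : IsNondegeneratePair a z := by
  refine ⟨h.isRotaryPair, h.three_le_orderOf, fun heq => ?_⟩
  have hazα : a.1.onV (z.1.onV α) = z.1.onV α := by
    obtain ⟨k, hk⟩ : a ∈ Subgroup.zpowers (z⁻¹ * a * z) := heq ▸ Subgroup.mem_zpowers a
    have h1 : (z⁻¹ * a * z) ∈ stabV G (z.1.onV α) := by
      simp [mem_stabV, h.a_vertex]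
    have := Subgroup.zpow_mem _ h1 k
    rw [← hk]
    exact this
  have hzz : z.1.onV (z.1.onV α) = α := by
    have := congrArg (fun g : G => g.1.onV α) h.z_mul_z
    simpa using this
  have inv : ∀ g : G, ∀ v, (g.1.onV v = α ∨ g.1.onV v = z.1.onV α) ↔ (v = α ∨ v = z.1.onV α) := by
    intro g
    have hg : g ∈ Subgroup.closure {a, z} := h.isRotaryPair.1 ▸ Subgroup.mem_top g
    induction hg using Subgroup.closure_induction with
    | mem x hx =>
      intro v
      rcases hx with rfl | rfl
      · refine or_congr ?_ ?_
        · conv_lhs => rw [← h.a_vertex]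
          exact x.1.onV.injective.eq_iff
        · conv_lhs => rw [← hazα]
          exact x.1.onV.injective.eq_iff
      · rw [or_comm]
        refine or_congr x.1.onV.injective.eq_iff ?_
        conv_lhs => rw [← hzz]
        exact x.1.onV.injective.eq_iff
    | one => exact fun v => Iff.rfl
    | mul x y _ _ hx hy => exact fun v => (hy (x.1.onV v)).trans (hx v)
    | inv x _ hx =>
      intro v
      have := hx ((x⁻¹).1.onV v)
      rw [Subgroup.coe_inv, onV_inv_onV] at this
      exact this.symm
  obtain ⟨v, hv, hv'⟩ := ENat.exists_ne_ne_of_three_le_card hV α (z.1.onV α)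
  obtain ⟨g, rfl⟩ := h.exists_vertex v
  rcases (inv g α).2 (Or.inl rfl) with h1 | h1
  exacts [hv h1, hv' h1]

theorem exists_equiv_vertices :
    ∃ φ : V ≃ RightCosets (Subgroup.zpowers a), ∀ g : G, φ (g.1.onV α) = rcoset _ g :=
  exists_equiv_rightCosets h.exists_vertex fun g k => by
    rw [← h.stabV_eq, mem_stabV, Subgroup.coe_mul, mul_onV, Subgroup.coe_inv, inv_onV_eq_iff]

theorem exists_equiv_edges :
    ∃ φ : E ≃ RightCosets (Subgroup.zpowers z), ∀ g : G, φ (g.1.onE e) = rcoset _ g :=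
  exists_equiv_rightCosets h.exists_edge fun g k => by
    rw [← h.stabE_eq, mem_stabE, Subgroup.coe_mul, mul_onE, Subgroup.coe_inv, inv_onE_eq_iff]

theorem cosetsMeet_iff {φV : V ≃ RightCosets (Subgroup.zpowers a)}
    {φE : E ≃ RightCosets (Subgroup.zpowers z)} (hφV : ∀ g : G, φV (g.1.onV α) = rcoset _ g)
    (hφE : ∀ g : G, φE (g.1.onE e) = rcoset _ g) (β : V) (y : E) :
    CosetsMeet (φV β) (φE y) ↔ M.incVE β y := by
  constructor
  · rintro ⟨g, h1, h2⟩
    rw [← hφV, φV.injective.eq_iff] at h1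
    rw [← hφE, φE.injective.eq_iff] at h2
    rw [← h1, ← h2, g.1.incVE_iff]
    exact h.incVE
  · intro hy
    obtain ⟨g, rfl, rfl⟩ := h.exists_arc hy
    exact ⟨g, (hφV g).symm, (hφE g).symm⟩

theorem equiv_vertices_mulRight {φV : V ≃ RightCosets (Subgroup.zpowers a)}
    (hφV : ∀ g : G, φV (g.1.onV α) = rcoset _ g) (g : G) (v : V) :
    φV (g.1.onV v) = (φV v).mulRight g := by
  obtain ⟨k, rfl⟩ := h.exists_vertex v
  rw [hφV]
  exact hφV (k * g)

theorem equiv_edges_mulRight {φE : E ≃ RightCosets (Subgroup.zpowers z)}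
    (hφE : ∀ g : G, φE (g.1.onE e) = rcoset _ g) (g : G) (x : E) :
    φE (g.1.onE x) = (φE x).mulRight g := by
  obtain ⟨k, rfl⟩ := h.exists_edge x
  rw [hφE]
  exact hφE (k * g)

theorem exists_face (k : F) : ∃ g : G, g.1.onF f = k := by
  obtain ⟨y, hy⟩ := exists_incEF h.isMap k
  obtain ⟨g, rfl⟩ := h.exists_edge y
  rcases h.face_eq hy with h1 | h1
  · exact ⟨g, h1.symm⟩
  · exact ⟨a * g, by rw [h1, ← h.a_face]; rfl⟩

theorem exists_face' (k : F) : ∃ g : G, g.1.onF f' = k := by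
  obtain ⟨g, rfl⟩ := h.exists_face k
  exact ⟨a⁻¹ * g, by rw [← h.a_face, Subgroup.coe_mul, mul_onF, Subgroup.coe_inv, inv_onF_onF]⟩

/-- All faces are equivalent under `G`, so they have the same length. -/
theorem faceLength_eq {k : F} (hk : M.incEF e k) {w : List (Arc V E)} (hw : w ∈ M.boundary k)
    (k' : F) : M.faceLength k' = w.length := by
  obtain ⟨g, rfl⟩ : ∃ g : G, g.1.onF k = k' := by
    rcases eq_or_eq_of_incEF h.twoFaced h.ne h.incEF h.incEF' hk with rfl | rfl
    · exact h.exists_face k'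
    · exact h.exists_face' k'
  have : w.map (Arc.map g.1.onV g.1.onE) ∈ M.boundary (g.1.onF k) := by
    rw [g.1.boundary_eq]; exact ⟨w, hw, rfl⟩
  rw [faceLength_eq_length h.isMap h.twoFaced this, List.length_map]

end IsRotaryFrame

namespace IsRotaryFrame

variable {G : Subgroup M.Aut} {α : V} {e : E} {f f' : F} {a z : G}

/-! ### Rotary maps: `z` interchanges the two faces -/

/-- The stabiliser `⟨az⟩` of `f` moves each arc on the boundary of `f` to the next one. -/
theorem exists_walk_of_swap (h : IsRotaryFrame G α e f f' a z) (hz : z.1.onF f' = f) :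
    0 < orderOf (a * z) ∧ (List.range (orderOf (a * z))).map (fun i =>
      (⟨α, e, z.1.onV α⟩ : Arc V E).map ((a * z) ^ i).1.onV ((a * z) ^ i).1.onE) ∈
        M.boundary f := by
  set x := a * z with hx
  have hxα : x.1.onV α = z.1.onV α := congrArg z.1.onV h.a_vertex
  have hxf : x.1.onF f = f := by
    rw [hx, Subgroup.coe_mul, mul_onF, h.a_face, hz]
  have hxif : ∀ i, (x ^ i).1.onF f = f := fun i => Subgroup.pow_mem (stabF G f) hxf i
  have hc : M.Consecutive f (z.1.onV α) e (x.1.onE e) := by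
    have := h.corner.map z.1
    rwa [hz, h.z_edge] at this
  obtain ⟨n, hn, hmem, hedge, hper⟩ := exists_walk_of_step h.isMap h.twoFaced (f := f)
    (s := fun i => (⟨α, e, z.1.onV α⟩ : Arc V E).map (x ^ i).1.onV (x ^ i).1.onE)
    (fun i => h.isArc.map _) (by simpa [Arc.map] using h.incEF)
    (fun i => by
      change (x ^ i).1.onV (z.1.onV α) = (x ^ (i + 1)).1.onV α
      rw [pow_succ', Subgroup.coe_mul, mul_onV, hxα])
    (fun i => by
      change M.Consecutive f ((x ^ i).1.onV (z.1.onV α)) ((x ^ i).1.onE e) ((x ^ (i + 1)).1.onE e)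
      have := hc.map (x ^ i).1
      rw [hxif] at this
      rwa [pow_succ', Subgroup.coe_mul, mul_onE])
  have hord : orderOf x = n := by
    refine Nat.dvd_antisymm (orderOf_dvd_of_pow_eq_one ?_) (hedge _ ?_)
    · have := hper n dvd_rfl
      simp only [Arc.map, pow_zero, Arc.mk.injEq] at this
      exact h.eq_one_of_arc this.1 this.2.1
    · simp only [pow_orderOf_eq_one, pow_zero]
  rw [hord]
  exact ⟨hn, hmem⟩

theorem stabF_eq_zpowers (h : IsRotaryFrame G α e f f' a z) (hz : z.1.onF f' = f) :
    stabF G f = Subgroup.zpowers (a * z) := by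
  have hxf : a * z ∈ stabF G f := by
    rw [mem_stabF, Subgroup.coe_mul, mul_onF, h.a_face, hz]
  refine le_antisymm (fun g hg => ?_) ((Subgroup.zpowers_le).2 hxf)
  have hw := (h.exists_walk_of_swap hz).2
  have hge : M.incEF (g.1.onE e) f := by
    have := (g.1.incEF_iff e f).2 h.incEF
    rwa [mem_stabF.1 hg] at this
  obtain ⟨p, hp, hpe⟩ := List.mem_map.1 ((incEF_iff_of_mem_boundary h.isMap hw).1 hge)
  obtain ⟨i, -, rfl⟩ := List.mem_map.1 hp
  have hxi := Subgroup.pow_mem _ hxf i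
  have h1 : (g * ((a * z) ^ i)⁻¹).1.onE e = e := by
    rw [Subgroup.coe_mul, mul_onE, Subgroup.coe_inv, inv_onE_eq_iff]
    exact hpe.symm
  rcases h.eq_one_or_eq_z h1 with h2 | h2
  · rw [mul_inv_eq_one.1 h2]
    exact Subgroup.pow_mem _ (Subgroup.mem_zpowers _) i
  · have h3 := mul_mem hg (inv_mem hxi)
    rw [h2, mem_stabF] at h3
    exact absurd (z.1.onF.injective (h3.trans hz.symm)) h.ne

theorem isRotary_of_swap (h : IsRotaryFrame G α e f f' a z) (hz : z.1.onF f' = f) :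
    IsRotary G := by
  refine ⟨h.isVertexRotary, h.isVertexRotary.1, fun k => ?_⟩
  obtain ⟨t, rfl⟩ := h.exists_face k
  have hx : (a * z) ∈ stabF G f := h.stabF_eq_zpowers hz ▸ Subgroup.mem_zpowers _
  refine ⟨t⁻¹ * (a * z) * t, ?_, fun g hg => ?_⟩
  · rw [mem_stabF, Subgroup.coe_mul, Subgroup.coe_mul, Subgroup.coe_inv, mul_onF, mul_onF,
      inv_onF_onF, mem_stabF.1 hx]
  · have h1 : t * g * t⁻¹ ∈ stabF G f := by
      rw [mem_stabF, Subgroup.coe_mul, Subgroup.coe_mul, Subgroup.coe_inv, mul_onF, mul_onF,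
        mem_stabF.1 hg, inv_onF_onF]
    rw [h.stabF_eq_zpowers hz] at h1
    obtain ⟨k, hk⟩ := h1
    refine ⟨k, fun y _ => ?_⟩
    have h2 : (t⁻¹ * (a * z) * t) ^ k = g := by
      have := conj_zpow (a := t⁻¹) (b := a * z) (i := k)
      rw [inv_inv] at this
      rw [this, show (a * z) ^ k = t * g * t⁻¹ from hk]
      group
    rw [h2]

/-- With orbit maps of `α`, `e` and `f` as components, the boundary walk of `f` becomes `C(az)`. -/
theorem exists_iso_rotaMap (h : IsRotaryFrame G α e f f' a z) (hz : z.1.onF f' = f) :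
    ∃ φ : M.Iso (RotaMap a z),
      φ.onV α = rcoset _ 1 ∧ φ.onE e = rcoset _ 1 ∧ φ.onF f = rcoset _ 1 ∧
      (∀ (g : G) (v : V), φ.onV (g.1.onV v) = (φ.onV v).mulRight g) ∧
      (∀ (g : G) (x : E), φ.onE (g.1.onE x) = (φ.onE x).mulRight g) ∧
      (∀ (g : G) (k : F), φ.onF (g.1.onF k) = (φ.onF k).mulRight g) := by
  have hM := h.isMap
  obtain ⟨φV, hφV⟩ := h.exists_equiv_vertices
  obtain ⟨φE, hφE⟩ := h.exists_equiv_edges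
  obtain ⟨φF, hφF⟩ : ∃ φ : F ≃ RightCosets (Subgroup.zpowers (a * z)),
      ∀ g : G, φ (g.1.onF f) = rcoset _ g :=
    exists_equiv_rightCosets h.exists_face fun g k => by
      rw [← h.stabF_eq_zpowers hz, mem_stabF, Subgroup.coe_mul, mul_onF, Subgroup.coe_inv,
        inv_onF_eq_iff]
  have hzf : z.1.onF f = f' := by
    rw [← hz]
    have := congrArg (fun g : G => g.1.onF f') h.z_mul_z
    simpa using this
  have hwalk : ∀ g : G, List.map (Arc.map φV φE) '' M.boundary (g.1.onF f) =
      seqClass (seqMulRight (rotaCycle a z) g) := by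
    intro g
    rw [g.1.boundary_eq, boundary_eq_seqClass hM (h.exists_walk_of_swap hz).2,
      map_image_seqClass, map_image_seqClass]
    congr 1
    simp only [seqMulRight, rotaCycle, List.map_map]
    refine List.map_congr_left fun i _ => ?_
    refine Arc.ext (hφV ((a * z) ^ i * g)) (hφE ((a * z) ^ i * g)) ?_
    refine Eq.trans ?_ (hφV ((a * z) ^ (i + 1) * g))
    change φV (g.1.onV (((a * z) ^ i).1.onV (z.1.onV α))) = _
    rw [pow_succ']
    simp only [Subgroup.coe_mul, mul_onV, h.a_vertex]
  refine ⟨⟨φV, φE, φF, h.cosetsMeet_iff hφV hφE, fun β k => ?_, fun y k => ?_, fun k => ?_⟩,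
    hφV 1, hφE 1, hφF 1, h.equiv_vertices_mulRight hφV, h.equiv_edges_mulRight hφE, fun g k => ?_⟩
  · rw [incVF_iff_exists_incVE hM]
    constructor
    · rintro ⟨g, h1, h2⟩
      rw [← hφV, φV.injective.eq_iff] at h1
      rw [← hφF, φF.injective.eq_iff] at h2
      rw [← h1, ← h2]
      exact ⟨g.1.onE e, (g.1.incVE_iff _ _).2 h.incVE, (g.1.incEF_iff _ _).2 h.incEF⟩
    · rintro ⟨y, hy, hyk⟩
      obtain ⟨g, rfl, rfl⟩ := h.exists_arc hy
      rcases h.face_eq hyk with rfl | rfl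
      · exact ⟨g, (hφV g).symm, (hφF g).symm⟩
      · refine ⟨a * g, ?_, ?_⟩
        · rw [← hφV, Subgroup.coe_mul, mul_onV, h.a_vertex]
        · rw [← hφF, Subgroup.coe_mul, mul_onF, h.a_face]
  · constructor
    · rintro ⟨g, h1, h2⟩
      rw [← hφE, φE.injective.eq_iff] at h1
      rw [← hφF, φF.injective.eq_iff] at h2
      rw [← h1, ← h2]
      exact (g.1.incEF_iff _ _).2 h.incEF
    · intro hy
      obtain ⟨g, rfl⟩ := h.exists_edge y
      rcases h.face_eq hy with rfl | rfl
      · exact ⟨g, (hφE g).symm, (hφF g).symm⟩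
      · refine ⟨z * g, ?_, ?_⟩
        · rw [← hφE, Subgroup.coe_mul, mul_onE, h.z_edge]
        · rw [← hφF, Subgroup.coe_mul, mul_onF, hzf]
  · ext w
    constructor
    · rintro ⟨g, h1, h2⟩
      rw [← hφF, φF.injective.eq_iff] at h1
      rwa [← h1, hwalk]
    · intro hw
      obtain ⟨g, rfl⟩ := h.exists_face k
      rw [hwalk] at hw
      exact ⟨g, (hφF g).symm, hw⟩
  · obtain ⟨t, rfl⟩ := h.exists_face k
    change φF ((t * g).1.onF f) = (φF (t.1.onF f)).mulRight g
    rw [hφF, hφF]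
    rfl

/-! ### Bi-rotary maps: `z` fixes the two faces -/

/-- The boundary walk of `f'` alternates between the `⟨zz^a⟩`-orbits of the arcs of `e` and `e ^ a`.
With `w = a⁻¹ z a`, the stabiliser of `f'` contains the reflections `z` and `w` of its boundary
walk, which reverse the consecutive edges `e` and `e ^ a`, so that `z w` moves the walk two steps
on. -/
theorem exists_walk_of_fix (h : IsRotaryFrame G α e f f' a z) (hz : z.1.onF f = f)
    (hz' : z.1.onF f' = f') :
    0 < orderOf (zza a z) ∧ ((List.range (orderOf (zza a z))).flatMap fun i =>
      [(⟨z.1.onV α, e, α⟩ : Arc V E).map (zza a z ^ i).1.onV (zza a z ^ i).1.onE,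
       (⟨α, a.1.onE e, (z * a).1.onV α⟩ : Arc V E).map (zza a z ^ i).1.onV (zza a z ^ i).1.onE]) ∈
        M.boundary f' := by
  have hM := h.isMap
  set u := zza a z with hu
  have a_inv_vertex : (a⁻¹).1.onV α = α := by
    rw [Subgroup.coe_inv, inv_onV_eq_iff, h.a_vertex]
  have hwf : (a⁻¹ * z * a).1.onF f' = f' := by
    simp only [Subgroup.coe_mul, mul_onF, Subgroup.coe_inv]
    rw [inv_onF_eq_iff.2 h.a_face.symm, hz, h.a_face]
  have hwα : (a⁻¹ * z * a).1.onV α = (z * a).1.onV α := by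
    rw [mul_assoc, Subgroup.coe_mul, mul_onV, a_inv_vertex]
  have hwe : (a⁻¹ * z * a).1.onE e = u.1.onE e := by
    rw [hu, zza, Subgroup.coe_mul _ z, mul_onE, h.z_edge]
  have hwae : (a⁻¹ * z * a).1.onE (a.1.onE e) = a.1.onE e := by
    simp [h.z_edge]
  have huf : u.1.onF f' = f' := by rw [hu, zza, Subgroup.coe_mul, mul_onF, hz', hwf]
  have huα : u.1.onV (z.1.onV α) = (z * a).1.onV α := by
    rw [← hwα, hu, zza, show (z * (a⁻¹ * z * a)).1.onV (z.1.onV α) =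
      (z * z * (a⁻¹ * z * a)).1.onV α from rfl, h.z_mul_z, one_mul]
  have huif : ∀ i, (u ^ i).1.onF f' = f' := fun i => Subgroup.pow_mem (stabF G f') huf i
  have hc : M.Consecutive f' ((z * a).1.onV α) (a.1.onE e) (u.1.onE e) := by
    have := h.corner.map (a⁻¹ * z * a).1
    rw [hwf, hwα, hwe, hwae] at this
    exact this.symm hM
  set q : Arc V E := ⟨z.1.onV α, e, α⟩ with hq
  set r : Arc V E := ⟨α, a.1.onE e, (z * a).1.onV α⟩ with hr
  have hqarc : M.IsArc q := h.isArc.rev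
  have hrarc : M.IsArc r := by
    have := h.isArc.map a.1
    rwa [Arc.map, h.a_vertex] at this
  set s : ℕ → Arc V E := fun i =>
    (if i % 2 = 0 then q else r).map (u ^ (i / 2)).1.onV (u ^ (i / 2)).1.onE with hs
  have hs0 : ∀ k, s (2 * k) = q.map (u ^ k).1.onV (u ^ k).1.onE := by
    intro k
    simp only [hs, show 2 * k % 2 = 0 by omega, show 2 * k / 2 = k by omega, if_true]
  have hs1 : ∀ k, s (2 * k + 1) = r.map (u ^ k).1.onV (u ^ k).1.onE := by
    intro k
    simp only [hs, show ¬ (2 * k + 1) % 2 = 0 by omega, show (2 * k + 1) / 2 = k by omega,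
      if_false]
  have hs2 : ∀ k, s (2 * k + 1 + 1) = q.map (u ^ (k + 1)).1.onV (u ^ (k + 1)).1.onE :=
    fun k => hs0 (k + 1)
  have hs00 : s 0 = q := hs0 0
  obtain ⟨n, hn, hmem, hedge, hper⟩ := exists_walk_of_step hM h.twoFaced (f := f') (s := s)
    (fun i => by
      obtain ⟨k, rfl | rfl⟩ := Nat.even_or_odd' i
      · rw [hs0]; exact hqarc.map _
      · rw [hs1]; exact hrarc.map _)
    (by rw [hs00]; exact h.incEF')
    (fun i => by
      obtain ⟨k, rfl | rfl⟩ := Nat.even_or_odd' i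
      · rw [hs0, hs1]; rfl
      · rw [hs1, hs2]
        change (u ^ k).1.onV ((z * a).1.onV α) = (u ^ (k + 1)).1.onV (z.1.onV α)
        rw [pow_succ', Subgroup.coe_mul _ u, mul_onV, huα])
    (fun i => by
      obtain ⟨k, rfl | rfl⟩ := Nat.even_or_odd' i
      · rw [hs0, hs1]
        have := h.corner.map (u ^ k).1
        rwa [huif] at this
      · rw [hs1, hs2]
        have := hc.map (u ^ k).1
        rw [huif] at this
        change M.Consecutive f' _ _ ((u ^ (k + 1)).1.onE e)
        rwa [pow_succ', Subgroup.coe_mul _ u, mul_onE])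
  -- an odd period would give an element mapping `e ^ a` to `e` that fixes `f'`
  obtain ⟨m, rfl⟩ : ∃ m, n = 2 * m := by
    obtain ⟨m, hm | hm⟩ := Nat.even_or_odd' n
    · exact ⟨m, hm⟩
    exfalso
    have h1 := hper n dvd_rfl
    rw [hm, hs1, hs00] at h1
    simp only [Arc.map, hq, hr, Arc.mk.injEq] at h1
    have h2 : (a * u ^ m).1.onE e = e := h1.2.1
    rcases h.eq_one_or_eq_z h2 with h3 | h3
    · have h4 : (a * u ^ m).1.onV α = z.1.onV α := by
        rw [Subgroup.coe_mul, mul_onV, h.a_vertex]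
        exact h1.1
      rw [h3] at h4
      exact h.z_vertex_ne h4.symm
    · have h4 : (a * u ^ m).1.onF f' = (u ^ m).1.onF f' := by rw [h3, hz', huif]
      have h5 : a.1.onF f' = f' := (u ^ m).1.onF.injective h4
      exact h.ne (a.1.onF.injective (h.a_face.trans h5.symm))
  have hord : orderOf u = m := by
    refine Nat.dvd_antisymm (orderOf_dvd_of_pow_eq_one ?_) ?_
    · have := hper _ dvd_rfl
      rw [hs0, hs00] at this
      simp only [Arc.map, hq, Arc.mk.injEq] at this
      exact h.eq_one_of_arc this.2.2 this.2.1
    · refine Nat.dvd_of_mul_dvd_mul_left (by norm_num : 0 < 2) (hedge _ ?_)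
      rw [hs0, hs00, pow_orderOf_eq_one]
      rfl
  rw [hord]
  refine ⟨by omega, ?_⟩
  rw [List.map_range_two_mul] at hmem
  simpa only [hs0, hs1] using hmem

/-- The stabiliser of `f'` acts faithfully on the edges of `f'`, so it would be cyclic, but it
contains the different involutions `z` and `a⁻¹ z a`. -/
theorem not_isFaceRotary_of_fix (h : IsRotaryFrame G α e f f' a z)
    (hnd : IsNondegeneratePair a z) (hz : z.1.onF f = f) (hz' : z.1.onF f' = f') :
    ¬ IsFaceRotary G := by
  rintro ⟨-, hcyc⟩
  have comm_ne : a * z ≠ z * a := by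
    intro hcomm
    refine hnd.2.2 ?_
    rw [mul_assoc, hcomm, inv_mul_cancel_left]
  have hwf : a⁻¹ * z * a ∈ stabF G f' := by
    simp only [mem_stabF, Subgroup.coe_mul, mul_onF, Subgroup.coe_inv]
    rw [inv_onF_eq_iff.2 h.a_face.symm, hz, h.a_face]
  have faithful : ∀ g : G, (∀ y ∈ M.edgesOf f', g.1.onE y = y) → g = 1 := by
    intro g hg
    refine (h.eq_one_or_eq_z (hg e h.incEF')).resolve_right ?_
    rintro rfl
    have h1 := hg _ (h.corner.incEF_right h.isMap)
    have h2 : (a * g * a⁻¹).1.onE e = e := by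
      rw [Subgroup.coe_mul, Subgroup.coe_mul, mul_onE, mul_onE, h1, Subgroup.coe_inv, inv_onE_onE]
    rcases h.eq_one_or_eq_z h2 with h3 | h3
    · exact h.z_ne_one (by simpa using h3)
    · exact comm_ne (mul_inv_eq_iff_eq_mul.1 h3)
  obtain ⟨c, hc, hgen⟩ := hcyc f'
  have gen : ∀ g ∈ stabF G f', g ∈ Subgroup.zpowers c := by
    intro g hg
    obtain ⟨k, hk⟩ := hgen g hg
    refine ⟨k, (mul_inv_eq_one.1 (faithful (g * (c ^ k)⁻¹) fun y hy => ?_)).symm⟩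
    rw [Subgroup.coe_mul, mul_onE, hk y hy, Subgroup.coe_inv, inv_onE_onE]
  have heq := Subgroup.eq_of_mem_zpowers_of_sq_eq_one (gen z hz') (gen _ hwf) h.z_mul_z
    (by simp [mul_assoc, ← mul_assoc z z, h.z_mul_z]) h.z_ne_one
    (fun h1 => h.z_ne_one (by simpa [mul_assoc, inv_mul_eq_one, eq_comm] using h1))
  exact comm_ne (by conv_lhs => rw [heq]
                    simp [mul_assoc])

/-- Different faces have different boundary cycles, so a face may be replaced by the image of its
boundary cycle under the orbit maps of `α` and `e`. -/
theorem exists_iso_biRoMap (h : IsRotaryFrame G α e f f' a z) (hz : z.1.onF f = f)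
    (hz' : z.1.onF f' = f') :
    ∃ φ : M.Iso (BiRoMap a z),
      φ.onV α = rcoset _ 1 ∧ φ.onE e = rcoset _ 1 ∧ φ.onF f' = biRoFace a z 1 ∧
      (∀ (g : G) (v : V), φ.onV (g.1.onV v) = (φ.onV v).mulRight g) ∧
      (∀ (g : G) (x : E), φ.onE (g.1.onE x) = (φ.onE x).mulRight g) ∧
      (∀ g : G, φ.onF (g.1.onF f') = biRoFace a z g) := by
  have hM := h.isMap
  obtain ⟨φV, hφV⟩ := h.exists_equiv_vertices
  obtain ⟨φE, hφE⟩ := h.exists_equiv_edges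
  have hwalk : ∀ g : G, List.map (Arc.map φV φE) '' M.boundary (g.1.onF f') =
      seqClass (seqMulRight (biRoCycle a z) g) := by
    intro g
    rw [g.1.boundary_eq, boundary_eq_seqClass hM (h.exists_walk_of_fix hz hz').2,
      map_image_seqClass, map_image_seqClass]
    congr 1
    simp only [seqMulRight, biRoCycle, List.map_flatMap, List.map_cons, List.map_nil]
    refine List.flatMap_congr fun i _ => ?_
    have hzu : z * zza a z ^ (i + 1) * g = a⁻¹ * (z * a * zza a z ^ i * g) := by
      rw [pow_succ', zza]
      simp only [← mul_assoc, h.z_mul_z, one_mul]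
    refine List.cons_eq_cons.2 ⟨Arc.ext (hφV (z * zza a z ^ i * g)) (hφE (zza a z ^ i * g))
      (hφV (zza a z ^ i * g)), List.cons_eq_cons.2 ⟨Arc.ext (hφV (zza a z ^ i * g))
      (hφE (a * zza a z ^ i * g)) ?_, rfl⟩⟩
    refine Eq.trans ?_ (hφV (z * zza a z ^ (i + 1) * g))
    rw [hzu, Subgroup.coe_mul _ a⁻¹, mul_onV, Subgroup.coe_inv, inv_onV_eq_iff.2 h.a_vertex.symm]
    rfl
  have hinj : ∀ {k k'}, List.map (Arc.map φV φE) '' M.boundary k =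
      List.map (Arc.map φV φE) '' M.boundary k' → k = k' := by
    intro k k' hk
    have hb := Set.image_injective.2
      (List.map_injective_iff.2 (Arc.map_injective φV.injective φE.injective)) hk
    obtain ⟨y, hy⟩ := exists_incEF hM k
    obtain ⟨β, hβ⟩ := exists_incVE hM y
    obtain ⟨x, hx⟩ := exists_consecutive' hM hβ hy
    refine h.cornerSimple.face_unique hx ?_
    rwa [Consecutive, ← hb]
  let ψ : F → BiRoFace a z := fun k => ⟨List.map (Arc.map φV φE) '' M.boundary k, by
    obtain ⟨g, rfl⟩ := h.exists_face' k
    exact ⟨g, hwalk g⟩⟩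
  have hψ : Function.Bijective ψ := by
    refine ⟨fun k k' hk => hinj (congrArg Subtype.val hk), ?_⟩
    rintro ⟨S, g, rfl⟩
    exact ⟨g.1.onF f', Subtype.ext (hwalk g)⟩
  have hψg : ∀ g : G, ψ (g.1.onF f') = biRoFace a z g := fun g => Subtype.ext (hwalk g)
  -- edges on the image of a walk
  have hedge : ∀ (k : F) (P : RightCosets (Subgroup.zpowers z) → Prop),
      (∃ w ∈ (ψ k).1, ∃ p ∈ w, P p.edge) ↔ ∃ y, M.incEF y k ∧ P (φE y) := by
    intro k P
    constructor
    · rintro ⟨-, ⟨w, hw, rfl⟩, p, hp, hP⟩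
      obtain ⟨q, hq, rfl⟩ := List.mem_map.1 hp
      exact ⟨q.edge, (hM.incEF_iff _ _).2 ⟨w, hw, q, hq, rfl⟩, hP⟩
    · rintro ⟨y, hy, hP⟩
      obtain ⟨w, hw, q, hq, rfl⟩ := (hM.incEF_iff _ _).1 hy
      exact ⟨_, ⟨w, hw, rfl⟩, _, List.mem_map_of_mem hq, hP⟩
  refine ⟨⟨φV, φE, Equiv.ofBijective ψ hψ, h.cosetsMeet_iff hφV hφE, fun β k => ?_, fun y k => ?_,
    fun k => rfl⟩, hφV 1, hφE 1, hψg 1, h.equiv_vertices_mulRight hφV,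
    h.equiv_edges_mulRight hφE, hψg⟩
  · refine (hedge k (CosetsMeet (φV β))).trans ?_
    rw [incVF_iff_exists_incVE hM]
    exact exists_congr fun y => by rw [h.cosetsMeet_iff hφV hφE, and_comm]
  · refine (hedge k (· = φE y)).trans ?_
    simp only [φE.injective.eq_iff, exists_eq_right]

end IsRotaryFrame

end MapConfig

/-! ### The classification -/

theorem theorem1p3 {V E F : Type*} (M : MapConfig V E F) (hM : M.IsLocallyFiniteMap)
    (hV : 3 ≤ ENat.card V) (hF : 3 ≤ ENat.card F)
    (G : Subgroup M.Aut) (hG : MapConfig.IsVertexRotary G)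
    (α : V) (e : E) (hαe : M.incVE α e) :
    {h | M.incEF e h}.encard = 2 ∧
    ∀ f f' : F, f ≠ f' → M.incEF e f → M.incEF e f' →
      -- there is a rotary pair for `G` that rotates one step about `α`, from `f` to `f'`
      (∃ a z : G, IsRotaryPair a z ∧
        MapConfig.stabV G α = Subgroup.zpowers a ∧ MapConfig.stabE G e = Subgroup.zpowers z ∧
        M.Consecutive f' α e (a.1.onE e)) ∧
      -- and every such pair determines the map
      ∀ a z : G, IsRotaryPair a z →
        MapConfig.stabV G α = Subgroup.zpowers a → MapConfig.stabE G e = Subgroup.zpowers z →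
        M.Consecutive f' α e (a.1.onE e) →
        a.1.onF f = f' ∧ IsNondegeneratePair a z ∧
        ((z.1.onF f = f' ∧ z.1.onF f' = f ∧
            IsOfFinOrder (a * z) ∧
            MapConfig.IsRotary G ∧
            (∃ φ : M.Iso (RotaMap a z),
              φ.onV α = rcoset _ 1 ∧ φ.onE e = rcoset _ 1 ∧ φ.onF f = rcoset _ 1 ∧
              (∀ (g : G) (v : V), φ.onV (g.1.onV v) = (φ.onV v).mulRight g) ∧
              (∀ (g : G) (x : E), φ.onE (g.1.onE x) = (φ.onE x).mulRight g) ∧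
              (∀ (g : G) (h : F), φ.onF (g.1.onF h) = (φ.onF h).mulRight g)) ∧
            ∀ h : F, M.faceLength h = orderOf (a * z))
          ∨
          (z.1.onF f = f ∧ z.1.onF f' = f' ∧
            IsOfFinOrder (zza a z) ∧
            MapConfig.IsBiRotary G ∧
            (∃ φ : M.Iso (BiRoMap a z),
              φ.onV α = rcoset _ 1 ∧ φ.onE e = rcoset _ 1 ∧ φ.onF f' = biRoFace a z 1 ∧
              (∀ (g : G) (v : V), φ.onV (g.1.onV v) = (φ.onV v).mulRight g) ∧
              (∀ (g : G) (x : E), φ.onE (g.1.onE x) = (φ.onE x).mulRight g) ∧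
              (∀ g : G, φ.onF (g.1.onF f') = biRoFace a z g)) ∧
            ∀ h : F, M.faceLength h = 2 * orderOf (zza a z))) := by
  have hC := MapConfig.isCornerSimple hM hF hG.1
  refine ⟨hC.twoFaced e, fun f f' hne hf hf' =>
    ⟨MapConfig.exists_isRotaryPair hC hG hαe hf', fun a z hp ha hz hc => ?_⟩⟩
  have h : MapConfig.IsRotaryFrame G α e f f' a z := ⟨hC, hG, hne, hαe, hf, hf', hp, ha, hz, hc⟩
  have hnd := h.isNondegeneratePair hV
  refine ⟨h.a_face, hnd, ?_⟩
  rcases h.z_face with ⟨h1, h2⟩ | ⟨h1, h2⟩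
  · obtain ⟨hpos, hw⟩ := h.exists_walk_of_swap h2
    refine Or.inl ⟨h1, h2, orderOf_pos_iff.1 hpos, h.isRotary_of_swap h2,
      h.exists_iso_rotaMap h2, fun k => ?_⟩
    rw [h.faceLength_eq hf hw, List.length_map, List.length_range]
  · obtain ⟨hpos, hw⟩ := h.exists_walk_of_fix h1 h2
    refine Or.inr ⟨h1, h2, orderOf_pos_iff.1 hpos,
      ⟨hG, h.not_isFaceRotary_of_fix hnd h1 h2⟩, h.exists_iso_biRoMap h1 h2, fun k => ?_⟩
    rw [h.faceLength_eq hf' hw]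
    simp [mul_comm]
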